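/- **Model.** Let $n\ge 1$, and let $G$ be a simple undirected graph with node set $[n]$. Which node of the graph gets which name is part of the adversary's choice of $G$. In the *online-LOCAL model with locality $T$*, the nodes are presented in an order $v_1,\dots,v_n$. When $v_i$ arrives, the algorithm sees the sequence $v_1,\dots,v_i$, the subgraph $G_i=G\big[\bigcup_{j\le i}\{u:\operatorname{dist}_G(u,v_j)\le T\}\big]$ induced by the radius-$T$ neighborhoods of the nodes presented so far, and its own previous outputs, and it must irrevocably choose the output of $v_i$. The algorithm knows $n$ and has unbounded memory and computational power. In the *randomized online-LOCAL model (oblivious adversary)* the algorithm also has access to random bits, and the graph and the order are fixed before any random bits are drawn; equivalently, a randomized algorithm for $n$-node graphs is a probability distribution over deterministic ones. A randomized algorithm *3-colors* a family of $n$-node graphs with locality $T$ if, for every $G$ in the family and every order, its output is a proper coloring of $G$ with 3 colors, with failure probability at most $1/n$. **Theorem.** 1. Any randomized online-LOCAL algorithm that 3-colors $\sqrt n\times\sqrt n$ grids has locality $\Omega(\log n)$. That is, there are a constant $c>0$ and an $m_0$ such that for all $m\ge m_0$, with $n=m^2$, every randomized online-LOCAL algorithm with locality $T$ that 3-colors the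 $m\times m$ grids (with arbitrary node names from $[n]$) satisfies $T\ge c\log n$. 2. Consequently, 3-coloring bipartite graphs is not possible with locality $o(\log n)$ in the randomized online-LOCAL model. That is, if $T:\mathbb N\to\mathbb N$ satisfies $T(n)=o(\log n)$, then there is no family $(\mathcal A_n)_n$ of randomized online-LOCAL algorithms such that for all sufficiently large $n$ the algorithm $\mathcal A_n$ 3-colors all bipartite $n$-node graphs with locality $T(n)$. -/

import Mathlib

/-!
The randomized online-LOCAL model (oblivious adversary) for graph colouring.

The node set of an `n`-node graph is `Fin n` and is known to the algorithm in advance; which node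
of the abstract graph carries which name is part of the (adversarial) choice of the input graph.
-/

namespace OnlineLocal

/-- The radius-`T` neighbourhood of the node `u` in `G` (distances are `⊤` between different
components). -/
def nbhd {V : Type*} (G : SimpleGraph V) (T : ℕ) (u : V) : Set V :=
  {v | G.edist u v ≤ (T : ℕ∞)}

/-- The subgraph of `G` induced by `S`, as a graph on the ambient node set without any edges
outside of `S`. -/
def restrict {V : Type*} (G : SimpleGraph V) (S : Set V) : SimpleGraph V where
  Adj u v := G.Adj u v ∧ u ∈ S ∧ v ∈ S
  symm := ⟨fun _ _ h => ⟨h.1.symm, h.2.2, h.2.1⟩⟩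
  loopless := ⟨fun _ h => G.irrefl h.1⟩

/-- Everything the algorithm knows when it has to label the node that arrives at time `i`
(times are `0, 1, …, n - 1`). -/
structure View (n : ℕ) (C : Type*) (i : Fin n) where
  /-- the nodes presented so far, in order; the last one is the node to be labelled now -/
  processed : Fin (i.val + 1) → Fin n
  /-- the union of the radius-`T` neighbourhoods of the presented nodes -/
  revealed : Set (Fin n)
  /-- the subgraph of the input graph induced by the revealed nodes -/
  graph : SimpleGraph (Fin n)
  /-- the labels given to the previously presented nodes, in order -/
  outputs : Fin i.val → C

/-- A deterministic online algorithm for `n`-node graphs with output labels in `C`. It is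
computationally unbounded and has a global memory: each label is an arbitrary function of all the
information obtained so far. -/
abbrev DetAlgorithm (n : ℕ) (C : Type*) := (i : Fin n) → View n C i → C

/-- The set of nodes revealed up to and including time `i`, if the nodes are presented in the
order `σ 0, σ 1, …` with visibility radius `T`. -/
def revealedAt {n : ℕ} (G : SimpleGraph (Fin n)) (T : ℕ) (σ : Equiv.Perm (Fin n)) (i : Fin n) :
    Set (Fin n) :=
  ⋃ j ∈ Set.Iic i, nbhd G T (σ j)

/-- The label that the algorithm gives to the node `σ i`, presented at time `i`, when it is run
with locality `T` on the graph `G` and the processing order `σ`. -/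
def labelAt {n : ℕ} {C : Type*} (A : DetAlgorithm n C) (G : SimpleGraph (Fin n)) (T : ℕ)
    (σ : Equiv.Perm (Fin n)) (i : Fin n) : C :=
  A i
    { processed := fun j => σ ⟨j.val, lt_of_le_of_lt (Nat.lt_succ_iff.mp j.isLt) i.isLt⟩
      revealed := revealedAt G T σ i
      graph := restrict G (revealedAt G T σ i)
      outputs := fun j => labelAt A G T σ ⟨j.val, j.isLt.trans i.isLt⟩ }
termination_by i.val
decreasing_by exact j.isLt

/-- The labelling of the nodes that the run of the algorithm produces. -/
def output {n : ℕ} {C : Type*} (A : DetAlgorithm n C) (G : SimpleGraph (Fin n)) (T : ℕ)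
    (σ : Equiv.Perm (Fin n)) (v : Fin n) : C :=
  labelAt A G T σ (σ.symm v)

/-- A labelling is a proper colouring if adjacent nodes have different labels. -/
def IsProper {V C : Type*} (G : SimpleGraph V) (c : V → C) : Prop :=
  ∀ u v, G.Adj u v → c u ≠ c v

/-- A randomized online algorithm for `n`-node graphs: a probability distribution over
deterministic ones (all random bits are drawn up front, independently of the input; for finite `C`
there are only finitely many deterministic algorithms for a given `n`, so that a discrete
distribution is no restriction). -/
abbrev RandAlgorithm (n : ℕ) (C : Type*) := PMF (DetAlgorithm n C)

/-- With locality `T`, the randomized algorithm `μ` properly colours every graph of the family `F`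
of `n`-node graphs with colours from `C`: for each graph and each processing order, both fixed
before the random bits are drawn, the failure probability is at most `1 / n`. -/
def Colors {n : ℕ} {C : Type*} (F : Set (SimpleGraph (Fin n))) (T : ℕ)
    (μ : RandAlgorithm n C) : Prop :=
  ∀ G ∈ F, ∀ σ : Equiv.Perm (Fin n),
    μ.toOuterMeasure {A | ¬ IsProper G (output A G T σ)} ≤ 1 / (n : ENNReal)

/-- The graphs with node set `Fin n` that are `m × m` grids for some `m` (so `n = m ^ 2`), with
arbitrarily named nodes. -/
def squareGrids (n : ℕ) : Set (SimpleGraph (Fin n)) :=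
  {G | ∃ m : ℕ, Nonempty
    (G ≃g (SimpleGraph.pathGraph m).boxProd (SimpleGraph.pathGraph m))}

/-- The bipartite graphs with node set `Fin n`. -/
def bipartiteGraphs (n : ℕ) : Set (SimpleGraph (Fin n)) :=
  {G | G.IsBipartite}

end OnlineLocal

namespace OnlineLocal

/-! ### Locality -/

/-! By a union bound it suffices to find fewer than `n` grids and one order such that every
deterministic algorithm fails on one of them (`not_colors_of_forall_exists`).

A properly 3-coloured path has a height function with steps ±1 that follows the colour modulo 3. The
steps around a 4-cycle cancel, so in a grid the increments of two rows at distance `d` over the same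
columns differ by at most `2 * d` (`abs_height_rows_le`). The adversary uses two rows at distance `2
* T + 3`, whose radius-`T` views do not touch. It forces height differences of at least `4 * T + 7`
in both, then shifts and possibly reflects the halves of the grid so that rise and fall oppose each
other over common columns, exceeding `2 * (2 * T + 3)` (`exists_common_length`,
`not_forall_isProper`).

Height differences are forced level by level: coloured pieces are joined in pairs, the second piece
reflected or not. Heights have the parity of positions, and the reflection changes that parity. So
if both pieces have the same spread, their peaks cannot be compatible in both joins, and one join
has larger spread; hence the average of `2 ^ (-spread)` drops (`merge_weights`). A single bit per
level serves all pairs at once, because the sum of these weights is averaged over the bit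
(`exists_weight_succ_le`). Thus `O(T)` bits suffice and there are only `2 ^ O(T)` inputs.

The algorithm cannot see the bits in advance: margins around the pieces ensure that later moves
carry each piece rigidly with everything visible from it (`exists_affOn_mul_arrange`,
`adj_position_iff`). -/

theorem mem_nbhd_succ {V : Type*} {G : SimpleGraph V} {t : ℕ} {u v : V} :
    v ∈ nbhd G (t + 1) u ↔ v ∈ nbhd G t u ∨ ∃ w ∈ nbhd G t u, G.Adj w v := by
  simp only [nbhd, Set.mem_ofPred_eq]
  constructor
  · intro h
    have hne : G.edist v u ≠ ⊤ := by
      rw [SimpleGraph.edist_comm]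
      exact ne_top_of_le_ne_top (ENat.natCast_ne_top _) h
    obtain ⟨p, hp⟩ := SimpleGraph.exists_walk_of_edist_ne_top hne
    rw [SimpleGraph.edist_comm, ← hp] at h
    cases p with
    | nil => left; simp
    | @cons _ w _ hadj q =>
      right
      refine ⟨w, ?_, hadj.symm⟩
      rw [SimpleGraph.edist_comm]
      refine (SimpleGraph.edist_le q).trans ?_
      simp only [SimpleGraph.Walk.length_cons] at h
      have h' : q.length + 1 ≤ t + 1 := by exact_mod_cast h
      exact_mod_cast (Nat.le_of_succ_le_succ h')
  · rintro (h | ⟨w, h, hadj⟩)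
    · exact h.trans (by exact_mod_cast Nat.le_succ t)
    · refine (SimpleGraph.edist_triangle (v := w)).trans ?_
      rw [SimpleGraph.edist_eq_one_iff_adj.2 hadj]
      push_cast
      gcongr

theorem nbhd_mono {V : Type*} (G : SimpleGraph V) (u : V) {s t : ℕ} (h : s ≤ t) :
    nbhd G s u ⊆ nbhd G t u := fun _ hv =>
  le_trans (show G.edist _ _ ≤ _ from hv) (by exact_mod_cast h)

theorem mem_nbhd_zero {V : Type*} {G : SimpleGraph V} {u v : V} : v ∈ nbhd G 0 u ↔ u = v := by
  simp [nbhd, eq_comm (a := v)]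

theorem nbhd_congr {V : Type*} {G G' : SimpleGraph V} {T : ℕ} {u : V}
    (h : ∀ w ∈ nbhd G T u, ∀ v, G.Adj w v ↔ G'.Adj w v) : nbhd G T u = nbhd G' T u := by
  suffices H : ∀ t ≤ T, nbhd G t u = nbhd G' t u from H T le_rfl
  intro t
  induction t with
  | zero => intro _; ext v; rw [mem_nbhd_zero, mem_nbhd_zero]
  | succ t ih =>
    intro ht
    have ih := ih (by omega)
    ext v
    rw [mem_nbhd_succ, mem_nbhd_succ, ← ih]
    refine or_congr Iff.rfl (exists_congr fun w => and_congr_right fun hw => ?_)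
    exact h w (nbhd_mono G u (by omega) hw) v

/-- If two inputs look the same around all nodes of a set that is presented first, then the
algorithm labels this set in the same way. -/
theorem labelAt_congr {n : ℕ} {C : Type*} (A : DetAlgorithm n C) {G G' : SimpleGraph (Fin n)}
    {T : ℕ} {σ : Equiv.Perm (Fin n)} {U : Set (Fin n)}
    (hU : ∀ i j, j ≤ i → σ i ∈ U → σ j ∈ U)
    (h : ∀ u ∈ U, ∀ w ∈ nbhd G T u, ∀ v, G.Adj w v ↔ G'.Adj w v) (i : Fin n) (hi : σ i ∈ U) :
    labelAt A G T σ i = labelAt A G' T σ i := by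
  induction hk : i.val using Nat.strong_induction_on generalizing i with
  | _ k ih =>
    have hrev : revealedAt G T σ i = revealedAt G' T σ i := by
      unfold revealedAt
      exact Set.iUnion₂_congr fun j hj => nbhd_congr (h _ (hU i j hj hi))
    have hgr : restrict G (revealedAt G T σ i) = restrict G' (revealedAt G' T σ i) := by
      rw [← hrev]
      ext u v
      simp only [restrict]
      refine and_congr_left fun ⟨hu, _⟩ => ?_
      simp only [revealedAt, Set.mem_iUnion] at hu
      obtain ⟨j, hj, hu⟩ := hu
      exact h _ (hU i j hj hi) u hu v
    have hout : (fun j : Fin i.val => labelAt A G T σ ⟨j.val, j.isLt.trans i.isLt⟩) =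
        fun j : Fin i.val => labelAt A G' T σ ⟨j.val, j.isLt.trans i.isLt⟩ := by
      funext j
      exact ih j.val (hk ▸ j.isLt) _ (hU i _ (Fin.le_def.2 j.isLt.le) hi) rfl
    rw [labelAt, labelAt, hgr, hrev, hout]

theorem output_congr {n : ℕ} {C : Type*} (A : DetAlgorithm n C) {G G' : SimpleGraph (Fin n)}
    {T : ℕ} {σ : Equiv.Perm (Fin n)} {U : Set (Fin n)}
    (hU : ∀ i j, j ≤ i → σ i ∈ U → σ j ∈ U)
    (h : ∀ u ∈ U, ∀ w ∈ nbhd G T u, ∀ v, G.Adj w v ↔ G'.Adj w v) {u : Fin n} (hu : u ∈ U) :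
    output A G T σ u = output A G' T σ u :=
  labelAt_congr A hU h _ (by simpa using hu)

/-- There is an order that presents the members of each set of an increasing chain before all
other nodes. -/
theorem exists_perm_initial {n : ℕ} (k : ℕ) (U : ℕ → Set (Fin n))
    (hU : ∀ i j, i ≤ j → j ≤ k → U i ⊆ U j) :
    ∃ σ : Equiv.Perm (Fin n), ∀ l ≤ k, ∀ i j, j ≤ i → σ i ∈ U l → σ j ∈ U l := by
  classical
  -- For a chain, this count is the index of the first set that contains `u`, or `k + 1` if there is
  -- none.
  let stage : Fin n → ℕ := fun u => ((Finset.range (k + 1)).filter fun i => u ∉ U i).card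
  refine ⟨Tuple.sort stage, fun l hl i j hij hi => ?_⟩
  have hmono : stage (Tuple.sort stage j) ≤ stage (Tuple.sort stage i) :=
    Tuple.monotone_sort stage hij
  by_contra hj
  have h1 : stage (Tuple.sort stage i) ≤ l := by
    calc _ ≤ (Finset.range l).card := by
          refine Finset.card_le_card fun t ht => ?_
          simp only [Finset.mem_filter, Finset.mem_range] at ht ⊢
          by_contra hlt
          exact ht.2 (hU l t (by omega) (by omega) hi)
      _ = l := Finset.card_range l
  have h2 : l + 1 ≤ stage (Tuple.sort stage j) := by
    calc l + 1 = (Finset.range (l + 1)).card := (Finset.card_range _).symm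
      _ ≤ _ := by
          refine Finset.card_le_card fun t ht => ?_
          simp only [Finset.mem_filter, Finset.mem_range] at ht ⊢
          exact ⟨by omega, fun h => hj (hU t l (by omega) hl h)⟩
  omega

/-! ### Grids given by coordinates -/

/-- The graph in which two nodes are adjacent if their positions in `ℤ × ℤ` are neighbours. -/
def gridOf {V : Type*} (P : V → ℤ × ℤ) : SimpleGraph V where
  Adj u v := |(P u).1 - (P v).1| + |(P u).2 - (P v).2| = 1
  symm := ⟨fun u v h => by rw [abs_sub_comm (P v).1, abs_sub_comm (P v).2]; exact h⟩
  loopless := ⟨fun u h => by simp at h⟩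

theorem gridOf_adj {V : Type*} {P : V → ℤ × ℤ} {u v : V} :
    (gridOf P).Adj u v ↔ |(P u).1 - (P v).1| + |(P u).2 - (P v).2| = 1 := Iff.rfl

theorem abs_le_of_mem_nbhd_gridOf {V : Type*} {P : V → ℤ × ℤ} {T : ℕ} {u v : V}
    (h : v ∈ nbhd (gridOf P) T u) : |(P v).1 - (P u).1| ≤ T ∧ |(P v).2 - (P u).2| ≤ T := by
  induction T generalizing v with
  | zero => rw [mem_nbhd_zero] at h; simp [h]
  | succ t ih =>
    rcases mem_nbhd_succ.1 h with h | ⟨w, hw, hadj⟩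
    · have := ih h
      push_cast
      omega
    · have := ih hw
      rw [gridOf_adj] at hadj
      have a1 := abs_sub_le (P v).1 (P w).1 (P u).1
      have a2 := abs_sub_le (P v).2 (P w).2 (P u).2
      rw [abs_sub_comm (P v).1 (P w).1] at a1
      rw [abs_sub_comm (P v).2 (P w).2] at a2
      have b1 := abs_nonneg ((P w).1 - (P v).1)
      have b2 := abs_nonneg ((P w).2 - (P v).2)
      push_cast
      omega

theorem gridOf_mem_squareGrids {m : ℕ} {P : Fin (m ^ 2) → ℤ × ℤ} (hinj : Function.Injective P)
    (h1 : ∀ u, (P u).1 ∈ Set.Ico (0 : ℤ) m) (h2 : ∀ u, (P u).2 ∈ Set.Ico (0 : ℤ) m) :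
    gridOf P ∈ squareGrids (m ^ 2) := by
  let f : Fin (m ^ 2) → Fin m × Fin m := fun u =>
    (⟨(P u).1.toNat, by have := h1 u; simp only [Set.mem_Ico] at this; omega⟩,
      ⟨(P u).2.toNat, by have := h2 u; simp only [Set.mem_Ico] at this; omega⟩)
  have hf : Function.Injective f := by
    intro u v huv
    apply hinj
    have a := h1 u; have b := h1 v; have c := h2 u; have d := h2 v
    simp only [f, Prod.mk.injEq, Fin.mk.injEq, Set.mem_Ico] at huv a b c d
    ext <;> omega
  have hb : Function.Bijective f :=
    (Fintype.bijective_iff_injective_and_card f).2 ⟨hf, by simp [sq]⟩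
  refine ⟨m, ⟨⟨Equiv.ofBijective f hb, ?_⟩⟩⟩
  intro u v
  have a := h1 u; have b := h1 v; have c := h2 u; have d := h2 v
  simp only [Set.mem_Ico] at a b c d
  simp only [Equiv.ofBijective_apply, SimpleGraph.boxProd_adj, SimpleGraph.pathGraph_adj, f,
    gridOf_adj, Fin.mk.injEq]
  grind

theorem squareGrids_subset_bipartiteGraphs (n : ℕ) : squareGrids n ⊆ bipartiteGraphs n := by
  rintro G ⟨m, ⟨e⟩⟩
  refine ⟨SimpleGraph.Coloring.mk
    (fun u => (⟨((e u).1.val + (e u).2.val) % 2, Nat.mod_lt _ two_pos⟩ : Fin 2)) ?_⟩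
  intro u v huv
  have h := e.map_rel_iff.2 huv
  simp only [SimpleGraph.boxProd_adj, SimpleGraph.pathGraph_adj, Fin.ext_iff] at h
  simp only [ne_eq, Fin.mk.injEq]
  omega

/-- Coordinates in the square `[0, m) × [0, m)` for the nodes `Fin (m ^ 2)`. -/
structure Coordinates (m : ℕ) where
  /-- the coordinates of a node -/
  coord : Fin (m ^ 2) → ℤ × ℤ
  /-- the node with given coordinates -/
  node : ℤ → ℤ → Fin (m ^ 2)
  fst_mem : ∀ u, (coord u).1 ∈ Set.Ico (0 : ℤ) m
  snd_mem : ∀ u, (coord u).2 ∈ Set.Ico (0 : ℤ) m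
  coord_node : ∀ x ∈ Set.Ico (0 : ℤ) m, ∀ y ∈ Set.Ico (0 : ℤ) m, coord (node x y) = (x, y)
  injective : Function.Injective coord

theorem nonempty_coordinates {m : ℕ} (hm : 0 < m) : Nonempty (Coordinates m) := by
  let E : Fin (m ^ 2) ≃ Fin m × Fin m := (finCongr (sq m)).trans finProdFinEquiv.symm
  -- The value outside the square is junk; `coord_node` never uses it.
  let c : ℤ → Fin m := fun x => if h : x.toNat < m then ⟨x.toNat, h⟩ else ⟨0, hm⟩
  refine ⟨⟨fun u => (((E u).1.val : ℤ), ((E u).2.val : ℤ)), fun x y => E.symm (c x, c y),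
    fun u => ⟨by positivity, by simp⟩, fun u => ⟨by positivity, by simp⟩, ?_, ?_⟩⟩
  · rintro x ⟨hx, hx'⟩ y ⟨hy, hy'⟩
    have h1 : x.toNat < m := by omega
    have h2 : y.toNat < m := by omega
    simp [c, h1, h2, hx, hy]
  · intro u v h
    simp only [Prod.mk.injEq, Nat.cast_inj] at h
    exact E.injective (Prod.ext (Fin.ext h.1) (Fin.ext h.2))

/-! ### Rearrangements of the columns -/

/-- The map is a translation or a reflection on the set. -/
def AffOn (f : ℤ → ℤ) (s : Set ℤ) : Prop :=
  ∃ ε c : ℤ, (ε = 1 ∨ ε = -1) ∧ ∀ z ∈ s, f z = ε * z + c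

theorem AffOn.comp {f f' : ℤ → ℤ} {s t : Set ℤ} (hf : AffOn f t) (hf' : AffOn f' s)
    (h : Set.MapsTo f' s t) : AffOn (f ∘ f') s := by
  obtain ⟨ε, c, hε, hf⟩ := hf
  obtain ⟨ε', c', hε', hf'⟩ := hf'
  refine ⟨ε * ε', ε * c' + c, ?_, fun z hz => ?_⟩
  · rcases hε with rfl | rfl <;> rcases hε' with rfl | rfl <;> simp
  · rw [Function.comp_apply, hf _ (h hz), hf' z hz]
    ring

theorem AffOn.mono {f : ℤ → ℤ} {s t : Set ℤ} (hf : AffOn f t) (h : s ⊆ t) : AffOn f s := by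
  obtain ⟨ε, c, hε, hf⟩ := hf
  exact ⟨ε, c, hε, fun z hz => hf z (h hz)⟩

theorem AffOn.abs_sub {f : ℤ → ℤ} {s : Set ℤ} (hf : AffOn f s) {z z' : ℤ} (hz : z ∈ s)
    (hz' : z' ∈ s) : |f z' - f z| = |z' - z| := by
  obtain ⟨ε, c, hε, hf⟩ := hf
  rw [hf z hz, hf z' hz']
  rcases hε with rfl | rfl
  · congr 1; ring
  · rw [← abs_neg]; congr 1; ring

/-- Points that an injective map brings close to the core of an interval on which it is
distance preserving come from the interval. -/
theorem AffOn.mem_of_abs_le {f : ℤ → ℤ} {a b d z z' : ℤ} (hf : AffOn f (Set.Ico a b))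
    (hinj : Function.Injective f) (h1 : a + d ≤ z) (h2 : z < b - d) (h : |f z' - f z| ≤ d) :
    z' ∈ Set.Ico a b := by
  obtain ⟨ε, c, hε, hf⟩ := hf
  have hd : 0 ≤ d := (abs_nonneg _).trans h
  have hz : f z = ε * z + c := hf z ⟨by omega, by omega⟩
  rw [hz, abs_le] at h
  have key : ∀ w ∈ Set.Ico a b, ε * w + c = f z' → z' ∈ Set.Ico a b := fun w hw hw' => by
    have : z' = w := hinj (by rw [hf w hw, hw'])
    rwa [this]
  rcases hε with rfl | rfl
  · exact key (f z' - c) ⟨by omega, by omega⟩ (by ring)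
  · exact key (c - f z') ⟨by omega, by omega⟩ (by ring)

/-- The reflection of the interval `[0, L)`. -/
def rev (L : ℤ) : Equiv.Perm ℤ :=
  Function.Involutive.toPerm (fun x => if 0 ≤ x ∧ x < L then L - 1 - x else x) (by
    intro x
    dsimp only
    split_ifs <;> omega)

theorem rev_apply (L x : ℤ) : rev L x = if 0 ≤ x ∧ x < L then L - 1 - x else x := rfl

/-- A rearrangement that shifts `[0, e)` by `t`, after a reflection unless `fl`. -/
def place (e : ℤ) (fl : Bool) (t : ℕ) : Equiv.Perm ℤ := rev (e + t) * (if fl then rev e else 1)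

/-- Two reflections compose to a translation. Built this way, the shift fixes all points outside
`[0, e + t)` and so permutes the columns of the grid. -/
theorem place_apply {e : ℤ} (fl : Bool) (t : ℕ) {x : ℤ} (h0 : 0 ≤ x) (h1 : x < e) :
    place e fl t x = if fl then x + t else e + t - 1 - x := by
  cases fl
  · simp only [place, Bool.false_eq_true, ↓reduceIte, mul_one, rev_apply]
    split_ifs <;> omega
  · simp only [place, ↓reduceIte, Equiv.Perm.mul_apply, rev_apply]
    split_ifs <;> omega

theorem place_mem_Ico {e m x : ℤ} (fl : Bool) {t : ℕ} (h : e + t ≤ m) (hx : x ∈ Set.Ico 0 m) :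
    place e fl t x ∈ Set.Ico 0 m := by
  simp only [Set.mem_Ico] at hx ⊢
  cases fl
  · simp only [place, Bool.false_eq_true, ↓reduceIte, mul_one, rev_apply]
    split_ifs <;> omega
  · simp only [place, ↓reduceIte, Equiv.Perm.mul_apply, rev_apply]
    split_ifs <;> omega

theorem affOn_place (e : ℤ) (fl : Bool) (t : ℕ) : AffOn (place e fl t) (Set.Ico 0 e) := by
  cases fl
  · refine ⟨-1, e + t - 1, Or.inr rfl, fun z hz => ?_⟩
    rw [place_apply _ _ hz.1 hz.2]
    simp only [Bool.false_eq_true, ↓reduceIte]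
    ring
  · refine ⟨1, t, Or.inl rfl, fun z hz => ?_⟩
    rw [place_apply _ _ hz.1 hz.2]
    simp

/-! ### Nested tiles with margins, and the reflections of a level -/

/-- The length of a tile of level `j`. -/
def tile (g k j : ℕ) : ℤ := 2 ^ j * (2 * (k + 1) * g + 2)

/-- The `p`-th tile of level `j`, without a margin of width `d` on both sides. -/
def shrunk (g k j : ℕ) (d p : ℤ) : Set ℤ :=
  Set.Ico (p * tile g k j + d * g) ((p + 1) * tile g k j - d * g)

/-- The part of a tile of level `j` that may be reflected. -/
def zone (g k j : ℕ) (p : ℤ) : Set ℤ := shrunk g k j (k - j) p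

/-- The part of a tile of level `j` that is coloured in stage `j`. -/
def slot (g k j : ℕ) (p : ℤ) : Set ℤ := shrunk g k j (k + 1 - j) p

theorem tile_pos (g k j : ℕ) : 0 < tile g k j := by unfold tile; positivity

theorem tile_add (g k i d : ℕ) : tile g k (i + d) = 2 ^ d * tile g k i := by
  unfold tile; ring

/-- Evenness makes the sum of a point and its mirror image in a tile, `(2 * p + 1) * tile g k j -
1`, odd: reflections change the parity of positions. -/
theorem even_tile (g k j : ℕ) : Even (tile g k j) :=
  ⟨2 ^ j * ((k + 1) * g + 1), by unfold tile; ring⟩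

theorem ediv_tile {g k j : ℕ} {d p x : ℤ} (hd : 0 ≤ d) (hx : x ∈ shrunk g k j d p) :
    x / tile g k j = p := by
  have h0 := tile_pos g k j
  have hdg : 0 ≤ d * g := by positivity
  have h1 := hx.1
  have h2 := hx.2
  apply le_antisymm
  · apply Int.lt_add_one_iff.1
    rw [Int.ediv_lt_iff_lt_mul h0]
    omega
  · rw [Int.le_ediv_iff_mul_le h0]
    omega

/-- Ends of higher tiles are multiples of the lower tile length, so a lower tile that meets a higher
one lies inside it, and its own margin is wide enough. -/
theorem shrunk_subset {g k i j : ℕ} {d d' q p x : ℤ} (hij : i ≤ j) (hd' : 0 ≤ d')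
    (hd : d' ≤ d) (hx : x ∈ shrunk g k i d q) (hx' : x / tile g k j = p) :
    shrunk g k i d q ⊆ shrunk g k j d' p := by
  obtain ⟨r, rfl⟩ := Nat.exists_eq_add_of_le hij
  have h0 := tile_pos g k i
  have h1 := tile_pos g k (i + r)
  have hdg : d' * g ≤ d * g := by gcongr
  have hdg' : 0 ≤ d' * g := by positivity
  have e1 : p * tile g k (i + r) ≤ x := by
    rw [← Int.le_ediv_iff_mul_le h1, hx']
  have e2 : x < (p + 1) * tile g k (i + r) := by
    rw [← Int.ediv_lt_iff_lt_mul h1, hx']; omega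
  have hx1 := hx.1
  have hx2 := hx.2
  rw [tile_add] at e1 e2
  have f1 : p * 2 ^ r < q + 1 := by
    refine lt_of_mul_lt_mul_right ?_ h0.le
    nlinarith
  have f2 : q < (p + 1) * 2 ^ r := by
    refine lt_of_mul_lt_mul_right ?_ h0.le
    nlinarith
  have g1 : p * 2 ^ r * tile g k i ≤ q * tile g k i := by
    gcongr; omega
  have g2 : (q + 1) * tile g k i ≤ (p + 1) * 2 ^ r * tile g k i := by
    gcongr; omega
  rw [mul_assoc] at g1 g2
  rintro y ⟨hy1, hy2⟩
  rw [shrunk, tile_add]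
  constructor <;> omega

theorem reflect_mem_shrunk {g k j : ℕ} {d p x : ℤ} (hx : x ∈ shrunk g k j d p) :
    (2 * p + 1) * tile g k j - 1 - x ∈ shrunk g k j d p := by
  have h1 := hx.1
  have h2 := hx.2
  have e : (2 * p + 1) * tile g k j = p * tile g k j + (p + 1) * tile g k j := by ring
  rw [e]
  constructor <;> omega

open Classical in
/-- The reflection of all zones of level `j` with an odd number. -/
noncomputable def flipFun (g k j : ℕ) (x : ℤ) : ℤ :=
  if x / tile g k j ∈ Set.Ico 0 (2 ^ (k - j)) ∧ Odd (x / tile g k j) ∧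
      x ∈ zone g k j (x / tile g k j) then
    (2 * (x / tile g k j) + 1) * tile g k j - 1 - x
  else x

section

variable {g k : ℕ}

theorem flipFun_of_odd {j : ℕ} {p x : ℤ} (hj : j ≤ k) (hp : p ∈ Set.Ico 0 (2 ^ (k - j)))
    (hodd : Odd p) (hx : x ∈ zone g k j p) :
    flipFun g k j x = (2 * p + 1) * tile g k j - 1 - x := by
  have h := ediv_tile (by omega) hx
  rw [flipFun, h, if_pos ⟨hp, hodd, hx⟩]

theorem flipFun_of_even {j : ℕ} {p x : ℤ} (hj : j ≤ k) (heven : Even p)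
    (hx : x ∈ zone g k j p) : flipFun g k j x = x := by
  have h := ediv_tile (by omega) hx
  rw [flipFun, h, if_neg]
  rintro ⟨_, hodd, _⟩
  exact Int.not_even_iff_odd.2 hodd heven

theorem flipFun_cases {j : ℕ} (hj : j ≤ k) (x : ℤ) : flipFun g k j x = x ∨
    ∃ p ∈ Set.Ico (0 : ℤ) (2 ^ (k - j)), Odd p ∧ x ∈ zone g k j p ∧
      flipFun g k j x ∈ zone g k j p := by
  by_cases h : x / tile g k j ∈ Set.Ico 0 (2 ^ (k - j)) ∧ Odd (x / tile g k j) ∧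
      x ∈ zone g k j (x / tile g k j)
  · right
    refine ⟨_, h.1, h.2.1, h.2.2, ?_⟩
    rw [flipFun_of_odd hj h.1 h.2.1 h.2.2]
    exact reflect_mem_shrunk h.2.2
  · left
    rw [flipFun, if_neg h]

theorem flipFun_involutive {j : ℕ} (hj : j ≤ k) : Function.Involutive (flipFun g k j) := by
  intro x
  rcases flipFun_cases (g := g) hj x with h | ⟨p, hp, hodd, hx, hx'⟩
  · rw [h, h]
  · rw [flipFun_of_odd hj hp hodd hx', flipFun_of_odd hj hp hodd hx]
    ring

theorem flipFun_mem_zone {j : ℕ} {p x : ℤ} (hj : j ≤ k) (hx : x ∈ zone g k j p) :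
    flipFun g k j x ∈ zone g k j p := by
  rcases flipFun_cases (g := g) hj x with h | ⟨q, _, _, hx', hx''⟩
  · rwa [h]
  · rwa [← ediv_tile (by omega) hx, ediv_tile (by omega) hx']

theorem affOn_flipFun {j : ℕ} {p : ℤ} (hj : j ≤ k) (hp : p ∈ Set.Ico 0 (2 ^ (k - j))) :
    AffOn (flipFun g k j) (zone g k j p) := by
  rcases Int.even_or_odd p with h | h
  · exact ⟨1, 0, Or.inl rfl, fun z hz => by rw [flipFun_of_even hj h hz]; ring⟩
  · exact ⟨-1, (2 * p + 1) * tile g k j - 1, Or.inr rfl,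
      fun z hz => by rw [flipFun_of_odd hj hp h hz]; ring⟩

/-- For `i < j` the margin `k - i` is at least `k + 1 - j`, so a reflected zone that meets a tile of
level `j` lies inside its slot. -/
theorem flipFun_mem_slot {i j : ℕ} {p x : ℤ} (hij : i < j) (hj : j ≤ k)
    (hx : x ∈ slot g k j p) : flipFun g k i x ∈ slot g k j p := by
  rcases flipFun_cases (g := g) (hij.le.trans hj) x with h | ⟨q, _, _, hx', hx''⟩
  · rwa [h]
  · exact shrunk_subset hij.le (by omega) (by omega) hx' (ediv_tile (by omega) hx) hx''

theorem zone_top : zone g k k 0 = Set.Ico 0 (tile g k k) := by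
  simp [zone, shrunk]

theorem half_mem_Ico {j : ℕ} {p : ℤ} (hj : j < k) (hp : p ∈ Set.Ico 0 (2 ^ (k - j))) :
    p / 2 ∈ Set.Ico 0 (2 ^ (k - (j + 1))) := by
  obtain ⟨h1, h2⟩ := hp
  have : k - j = (k - (j + 1)) + 1 := by omega
  rw [this, pow_succ] at h2
  constructor <;> omega

/-- Both margins equal `(k - j) * g`: what may be reflected at level `j` is part of what is coloured
in stage `j + 1`. -/
theorem zone_subset_slot {j : ℕ} (p : ℤ) (hj : j < k) :
    zone g k j p ⊆ slot g k (j + 1) (p / 2) := by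
  intro x hx
  refine shrunk_subset (Nat.le_succ j) (by push_cast; omega) (by push_cast; omega) hx ?_ hx
  rw [Nat.succ_eq_add_one, tile_add, pow_one, mul_comm,
    ← Int.ediv_ediv_of_nonneg (tile_pos g k j).le, ediv_tile (by omega) hx]

theorem slot_subset_zone {j : ℕ} (p : ℤ) : slot g k j p ⊆ zone g k j p := by
  rintro x ⟨h1, h2⟩
  have e : ((k : ℤ) + 1 - j) * g = (k - j) * g + g := by ring
  rw [e] at h1 h2
  constructor <;> omega

theorem zone_subset_Ico {j : ℕ} {p : ℤ} (hj : j ≤ k) (hp : p ∈ Set.Ico 0 (2 ^ (k - j))) :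
    zone g k j p ⊆ Set.Ico 0 (tile g k k) := by
  rintro x ⟨h1, h2⟩
  have h0 := tile_pos g k j
  have e : tile g k k = 2 ^ (k - j) * tile g k j := by
    rw [← tile_add]; congr 1; omega
  have hp2 : p + 1 ≤ 2 ^ (k - j) := hp.2
  have a1 : 0 ≤ p * tile g k j := mul_nonneg hp.1 h0.le
  have a2 : (p + 1) * tile g k j ≤ tile g k k := by rw [e]; gcongr
  have a3 : 0 ≤ ((k : ℤ) - j) * g := mul_nonneg (by omega) (by positivity)
  constructor <;> omega

/-! ### Composing the levels -/

/-- The arrangement of the columns after the first `j` levels of reflections, where the bits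
tell which levels are performed. -/
noncomputable def arrange (g k : ℕ) (b : ℕ → Bool) : ℕ → Equiv.Perm ℤ
  | 0 => 1
  | j + 1 => if h : b j = true ∧ j ≤ k then
      (flipFun_involutive (g := g) h.2).toPerm * arrange g k b j else arrange g k b j

theorem arrange_succ_of_false {b : ℕ → Bool} {j : ℕ} (h : b j = false) :
    arrange g k b (j + 1) = arrange g k b j := by
  simp [arrange, h]

theorem arrange_succ_apply_of_true {b : ℕ → Bool} {j : ℕ} (hj : j ≤ k) (h : b j = true) (x : ℤ) :
    arrange g k b (j + 1) x = flipFun g k j (arrange g k b j x) := by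
  simp [arrange, h, hj]

theorem arrange_congr {b b' : ℕ → Bool} {j : ℕ} (h : ∀ i < j, b i = b' i) :
    arrange g k b j = arrange g k b' j := by
  induction j with
  | zero => rfl
  | succ j ih =>
    simp only [arrange, h j (Nat.lt_succ_self j), ih fun i hi => h i (by omega)]

theorem arrange_mem_slot {b : ℕ → Bool} {i j : ℕ} {p x : ℤ} (hij : i ≤ j) (hj : j ≤ k) :
    arrange g k b i x ∈ slot g k j p ↔ x ∈ slot g k j p := by
  induction i with
  | zero => rfl
  | succ i ih =>
    rw [← ih (by omega)]
    cases hb : b i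
    · rw [arrange_succ_of_false hb]
    · rw [arrange_succ_apply_of_true (by omega) hb]
      refine ⟨fun h => ?_, flipFun_mem_slot (by omega) hj⟩
      have := flipFun_mem_slot (i := i) (by omega) hj h
      rwa [flipFun_involutive (by omega)] at this

/-- This is why `flipFun` restricts the tile number: only points of the top tile ever move. -/
theorem arrange_mem_Ico {b : ℕ → Bool} {i : ℕ} {m x : ℤ} (hi : i ≤ k) (hm : tile g k k ≤ m)
    (hx : x ∈ Set.Ico 0 m) : arrange g k b i x ∈ Set.Ico 0 m := by
  induction i with
  | zero => exact hx
  | succ i ih =>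
    have ih := ih (by omega)
    cases hb : b i
    · rwa [arrange_succ_of_false hb]
    · rw [arrange_succ_apply_of_true (by omega) hb]
      rcases flipFun_cases (g := g) (show i ≤ k by omega) (arrange g k b i x) with
        h | ⟨p, hp, _, _, h⟩
      · rwa [h]
      · have := zone_subset_Ico (by omega) hp h
        exact ⟨this.1, this.2.trans_le hm⟩

/-- After the first `j` levels, the remaining rearrangement moves each zone of level `j`
rigidly. -/
theorem exists_affOn_mul_arrange (b : ℕ → Bool) {θ : Equiv.Perm ℤ}
    (hθ : AffOn θ (Set.Ico 0 (tile g k k))) {j : ℕ} (hj : j ≤ k) :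
    ∃ Q : Equiv.Perm ℤ, θ * arrange g k b k = Q * arrange g k b j ∧
      ∀ p ∈ Set.Ico (0 : ℤ) (2 ^ (k - j)), AffOn Q (zone g k j p) := by
  -- Downward induction on the level: a reflection of level `j` maps each zone rigidly to itself,
  -- and that zone lies in one of level `j + 1`, where the later moves are rigid.
  induction hd : k - j generalizing j with
  | zero =>
    obtain rfl : j = k := by omega
    refine ⟨θ, rfl, fun p hp => ?_⟩
    obtain rfl : p = 0 := by
      simp only [pow_zero, Set.mem_Ico] at hp; omega
    rwa [zone_top]
  | succ d ih =>
    obtain ⟨Q, hQ, hA⟩ := ih (show j + 1 ≤ k by omega) (by omega)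
    cases hb : b j
    · refine ⟨Q, by rw [hQ, arrange_succ_of_false hb], fun p hp => ?_⟩
      rw [← hd] at hp
      have := half_mem_Ico (by omega) hp
      refine (hA _ ?_).mono ((zone_subset_slot p (by omega)).trans (slot_subset_zone _))
      rwa [show d = k - (j + 1) by omega]
    · refine ⟨Q * (flipFun_involutive (g := g) hj).toPerm, ?_, fun p hp => ?_⟩
      · rw [hQ]
        ext x
        simp only [Equiv.Perm.mul_apply, arrange_succ_apply_of_true hj hb,
          Function.Involutive.coe_toPerm]
      · rw [← hd] at hp
        have := half_mem_Ico (by omega) hp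
        refine (hA (p / 2) ?_).comp (affOn_flipFun hj hp) fun x hx =>
          slot_subset_zone _ (zone_subset_slot p (by omega) (flipFun_mem_zone hj hx))
        rwa [show d = k - (j + 1) by omega]

end

/-! ### Heights -/

/-- The step, in a height function modulo `3`, between two different colours. -/
def step (a b : Fin 3) : ℤ := if b = a + 1 then 1 else -1

theorem step_swap {a b : Fin 3} (h : a ≠ b) : step b a = -step a b := by
  revert a b; decide

/-- The sum of the four steps around a 4-cycle is even, divisible by 3 and at most 4 in absolute
value, hence zero. -/
theorem step_square {a b c d : Fin 3} (h1 : a ≠ b) (h2 : b ≠ c) (h3 : a ≠ d) (h4 : d ≠ c) :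
    step a b + step b c = step a d + step d c := by
  revert a b c d; decide

theorem abs_step (a b : Fin 3) : |step a b| = 1 := by
  revert a b; decide

/-- The height function of a sequence of colours, normalised at `0`. -/
def height (f : ℤ → Fin 3) (z : ℤ) : ℤ :=
  ∑ i ∈ Finset.range z.toNat, step (f i) (f (i + 1))

theorem height_succ (f : ℤ → Fin 3) {z : ℤ} (hz : 0 ≤ z) :
    height f (z + 1) = height f z + step (f z) (f (z + 1)) := by
  obtain ⟨n, rfl⟩ := Int.eq_ofNat_of_zero_le hz
  have : ((n : ℤ) + 1).toNat = n + 1 := by omega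
  simp only [height, this, Int.toNat_natCast, Finset.sum_range_succ]

theorem even_height_add (f : ℤ → Fin 3) {z : ℤ} (hz : 0 ≤ z) : Even (height f z + z) := by
  induction z, hz using Int.leInduction with
  | base => simp [height]
  | succ z hz ih =>
    rw [height_succ f hz]
    have := abs_step (f z) (f (z + 1))
    grind

/-- A reflection traverses each step backwards, which negates it, so corresponding points keep their
height differences. Properness is needed only for this sign. -/
theorem height_sub_height_of_affine {f f' : ℤ → Fin 3} {φ : ℤ → ℤ} {a b ε c : ℤ} (ha : 0 ≤ a)
    (hε : ε = 1 ∨ ε = -1) (hφ : ∀ z ∈ Set.Ico a b, φ z = ε * z + c)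
    (hφ0 : ∀ z ∈ Set.Ico a b, 0 ≤ φ z)
    (hf : ∀ z, z ∈ Set.Ico a b → z + 1 ∈ Set.Ico a b → f z ≠ f (z + 1))
    (h : ∀ z ∈ Set.Ico a b, f' (φ z) = f z) {z z' : ℤ} (hz : z ∈ Set.Ico a b)
    (hz' : z' ∈ Set.Ico a b) :
    height f' (φ z') - height f' (φ z) = height f z' - height f z := by
  suffices H : ∀ z, a ≤ z → z < b →
      height f' (φ z) - height f' (φ a) = height f z - height f a by
    have h1 := H z hz.1 hz.2
    have h2 := H z' hz'.1 hz'.2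
    omega
  intro z hz
  induction z, hz using Int.leInduction with
  | base => intro _; ring
  | succ z hz ih =>
    intro hb
    have ih := ih (by omega)
    have m1 : z ∈ Set.Ico a b := ⟨hz, by omega⟩
    have m2 : z + 1 ∈ Set.Ico a b := ⟨by omega, hb⟩
    have e1 := hφ z m1
    have e2 := hφ (z + 1) m2
    have c1 := h z m1
    have c2 := h (z + 1) m2
    have n1 := hφ0 z m1
    have n2 := hφ0 (z + 1) m2
    rw [height_succ f (by omega)]
    rcases hε with rfl | rfl
    · have e : φ (z + 1) = φ z + 1 := by omega
      rw [e] at c2 ⊢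
      rw [height_succ f' n1, c1, c2]
      omega
    · have e : φ z = φ (z + 1) + 1 := by omega
      have hs := height_succ f' n2
      rw [← e, c1, c2, step_swap (hf z m1 m2)] at hs
      omega

/-! ### Spread of heights and its growth under joining -/

/-- The difference between the largest and the smallest height on an interval. -/
noncomputable def spread (f : ℤ → Fin 3) (a b : ℤ) : ℕ :=
  (Finset.Ico a b ×ˢ Finset.Ico a b).sup fun q => (height f q.1 - height f q.2).natAbs

theorem sub_le_spread (f : ℤ → Fin 3) {a b u v : ℤ} (hu : u ∈ Set.Ico a b) (hv : v ∈ Set.Ico a b) :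
    height f v - height f u ≤ spread f a b := by
  have : (height f v - height f u).natAbs ≤ spread f a b :=
    Finset.le_sup (f := fun q : ℤ × ℤ => (height f q.1 - height f q.2).natAbs) (b := (v, u))
      (by simp only [Finset.mem_product, Finset.mem_Ico]; exact ⟨hv, hu⟩)
  omega

theorem exists_spread_eq (f : ℤ → Fin 3) {a b : ℤ} (hab : a < b) :
    ∃ u ∈ Set.Ico a b, ∃ v ∈ Set.Ico a b, height f v - height f u = spread f a b := by
  have hne : (Finset.Ico a b ×ˢ Finset.Ico a b).Nonempty := by
    simp [hab]
  obtain ⟨q, hq, h⟩ := Finset.exists_mem_eq_sup _ hne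
    fun q : ℤ × ℤ => (height f q.1 - height f q.2).natAbs
  simp only [Finset.mem_product, Finset.mem_Ico] at hq
  change spread f a b = _ at h
  rcases le_total (height f q.1) (height f q.2) with hle | hle
  · exact ⟨q.1, hq.1, q.2, hq.2, by omega⟩
  · exact ⟨q.2, hq.2, q.1, hq.1, by omega⟩

theorem spread_le_of_affine {f f' : ℤ → Fin 3} {φ : ℤ → ℤ} {a b a' b' ε c : ℤ} (ha : 0 ≤ a)
    (hab : a < b) (ha' : 0 ≤ a')
    (hε : ε = 1 ∨ ε = -1) (hφ : ∀ z ∈ Set.Ico a b, φ z = ε * z + c)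
    (hφ0 : ∀ z ∈ Set.Ico a b, φ z ∈ Set.Ico a' b')
    (hf : ∀ z, z ∈ Set.Ico a b → z + 1 ∈ Set.Ico a b → f z ≠ f (z + 1))
    (h : ∀ z ∈ Set.Ico a b, f' (φ z) = f z) : spread f a b ≤ spread f' a' b' := by
  obtain ⟨u, hu, v, hv, huv⟩ := exists_spread_eq f hab
  have := height_sub_height_of_affine ha hε hφ (fun z hz => ha'.trans (hφ0 z hz).1) hf h hu hv
  have := sub_le_spread f' (hφ0 u hu) (hφ0 v hv)
  omega

/-- If the spread of two intervals does not grow when they are joined, then highest points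
have the same parity. -/
theorem even_sub_of_spread_le {f : ℤ → Fin 3} {a b u₁ v₁ u₂ v₂ : ℤ} {r : ℕ} (ha : 0 ≤ a)
    (hu₁ : u₁ ∈ Set.Ico a b) (hv₁ : v₁ ∈ Set.Ico a b) (hu₂ : u₂ ∈ Set.Ico a b)
    (hv₂ : v₂ ∈ Set.Ico a b) (h₁ : height f v₁ - height f u₁ = r)
    (h₂ : height f v₂ - height f u₂ = r) (h : spread f a b ≤ r) : Even (v₂ - v₁) := by
  -- Neither peak can exceed the other without exceeding the other piece's lowest point by more than
  -- `r`. So the peaks are level, and parity of height is parity of position.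
  have i1 := sub_le_spread f hu₁ hv₂
  have i2 := sub_le_spread f hu₂ hv₁
  have e1 := even_height_add f (ha.trans hv₁.1)
  have e2 := even_height_add f (ha.trans hv₂.1)
  have : height f v₁ = height f v₂ := by omega
  grind

/-- Two intervals are joined in two ways that differ in the parity of the distance. Then the
average of `2 ^ (-spread)` decreases. -/
theorem merge_weights {f f₀ f₁ : ℤ → Fin 3} {a b a₁ b₁ a₂ b₂ c : ℤ} (ha : 0 ≤ a)
    (h1 : a₁ < b₁) (h2 : a₂ < b₂) (hc : Odd c)
    (hs1 : Set.Ico a₁ b₁ ⊆ Set.Ico a b) (hs2 : Set.Ico a₂ b₂ ⊆ Set.Ico a b)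
    (hp1 : ∀ z, z ∈ Set.Ico a₁ b₁ → z + 1 ∈ Set.Ico a₁ b₁ → f z ≠ f (z + 1))
    (hp2 : ∀ z, z ∈ Set.Ico a₂ b₂ → z + 1 ∈ Set.Ico a₂ b₂ → f z ≠ f (z + 1))
    (hf01 : ∀ z ∈ Set.Ico a₁ b₁, f₀ z = f z) (hf02 : ∀ z ∈ Set.Ico a₂ b₂, f₀ z = f z)
    (hf11 : ∀ z ∈ Set.Ico a₁ b₁, f₁ z = f z)
    (hc2 : ∀ z ∈ Set.Ico a₂ b₂, c - z ∈ Set.Ico a₂ b₂)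
    (hf12 : ∀ z ∈ Set.Ico a₂ b₂, f₁ (c - z) = f z) :
    (1 / 2 : ℝ) ^ spread f₀ a b + (1 / 2 : ℝ) ^ spread f₁ a b ≤
      3 / 4 * ((1 / 2 : ℝ) ^ spread f a₁ b₁ + (1 / 2 : ℝ) ^ spread f a₂ b₂) := by
  have p1 : 0 ≤ a₁ := ha.trans (hs1 ⟨le_rfl, h1⟩).1
  have p2 : 0 ≤ a₂ := ha.trans (hs2 ⟨le_rfl, h2⟩).1
  have id1 : ∀ {s : Set ℤ}, ∀ z ∈ s, (fun z : ℤ => z) z = 1 * z + 0 := fun z _ => by simp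
  have id2 : ∀ {s : Set ℤ}, ∀ z ∈ s, (fun z : ℤ => c - z) z = -1 * z + c := fun z _ => by ring
  have n1 : ∀ z ∈ Set.Ico a₁ b₁, 0 ≤ z := fun z hz => p1.trans hz.1
  have n2 : ∀ z ∈ Set.Ico a₂ b₂, 0 ≤ z := fun z hz => p2.trans hz.1
  have n3 : ∀ z ∈ Set.Ico a₂ b₂, 0 ≤ c - z := fun z hz => p2.trans (hc2 z hz).1
  have s01 := spread_le_of_affine p1 h1 ha (Or.inl rfl) id1 (fun z hz => hs1 hz) hp1 hf01
  have s02 := spread_le_of_affine p2 h2 ha (Or.inl rfl) id1 (fun z hz => hs2 hz) hp2 hf02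
  have s11 := spread_le_of_affine p1 h1 ha (Or.inl rfl) id1 (fun z hz => hs1 hz) hp1 hf11
  have s12 := spread_le_of_affine p2 h2 ha (Or.inr rfl) id2 (fun z hz => hs2 (hc2 z hz)) hp2 hf12
  have mono : ∀ {i j : ℕ}, i ≤ j → (1 / 2 : ℝ) ^ j ≤ (1 / 2 : ℝ) ^ i := fun h =>
    pow_le_pow_of_le_one (by norm_num) (by norm_num) h
  have half : ∀ {i j : ℕ}, i < j → (1 / 2 : ℝ) ^ j ≤ 1 / 2 * (1 / 2 : ℝ) ^ i := fun h => by
    have := mono (Nat.succ_le_of_lt h)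
    rw [pow_succ] at this
    linarith
  have pos : ∀ i : ℕ, 0 < (1 / 2 : ℝ) ^ i := fun i => by positivity
  -- For unequal spreads monotonicity is enough: if `w' ≤ w / 2` are the two weights, both joins
  -- weigh at most `w'`, and `2 * w' ≤ 3 / 4 * (w + w')`.
  rcases lt_trichotomy (spread f a₁ b₁) (spread f a₂ b₂) with hlt | heq | hlt
  · have := half hlt
    have := mono s02
    have := mono s12
    have := pos (spread f a₂ b₂)
    linarith
  -- If neither join raised the spread, both `v₂ - v₁` and `(c - v₂) - v₁` would be even, which is
  -- impossible for odd `c`.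
  · have key : spread f a₁ b₁ < spread f₀ a b ∨ spread f a₁ b₁ < spread f₁ a b := by
      by_contra! hcon
      obtain ⟨u₁, hu₁, v₁, hv₁, e₁⟩ := exists_spread_eq f h1
      obtain ⟨u₂, hu₂, v₂, hv₂, e₂⟩ := exists_spread_eq f h2
      rw [← heq] at e₂
      have t1 := height_sub_height_of_affine p1 (Or.inl rfl) id1 n1 hp1 hf01 hu₁ hv₁
      have t2 := height_sub_height_of_affine p2 (Or.inl rfl) id1 n2 hp2 hf02 hu₂ hv₂
      have t3 := height_sub_height_of_affine p1 (Or.inl rfl) id1 n1 hp1 hf11 hu₁ hv₁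
      have t4 := height_sub_height_of_affine p2 (Or.inr rfl) id2 n3 hp2 hf12 hu₂ hv₂
      have q1 := even_sub_of_spread_le ha (hs1 hu₁) (hs1 hv₁) (hs2 hu₂) (hs2 hv₂)
        (t1.trans e₁) (t2.trans e₂) hcon.1
      have q2 := even_sub_of_spread_le ha (hs1 hu₁) (hs1 hv₁) (hs2 (hc2 _ hu₂)) (hs2 (hc2 _ hv₂))
        (t3.trans e₁) (t4.trans e₂) hcon.2
      grind
    rw [← heq]
    rcases key with h | h
    · have := half h
      have := mono s11
      linarith
    · have := half h
      have := mono s01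
      linarith
  · have := half hlt
    have := mono s01
    have := mono s11
    have := pos (spread f a₁ b₁)
    linarith

/-- Two functions that increase by `r` on some intervals increase by `r` in total on two
subintervals of the same length. -/
theorem exists_common_length {f h : ℤ → ℤ} {r : ℤ} (hr : 0 < r) {lo hi : ℤ} (l l' : ℕ) :
    ∀ {a b : ℤ}, lo ≤ a → a + l < hi → lo ≤ b → b + l' < hi →
    r ≤ f (a + l) - f a → r ≤ h (b + l') - h b →
    ∃ (s : ℕ) (a' b' : ℤ), lo ≤ a' ∧ a' + s < hi ∧ lo ≤ b' ∧ b' + s < hi ∧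
      r ≤ (f (a' + s) - f a') + (h (b' + s) - h b') := by
  induction hn : l + l' using Nat.strong_induction_on generalizing l l' with
  | _ n ih =>
    intro a b ha1 ha2 hb1 hb2 hf hh
    rcases Nat.eq_zero_or_pos l with rfl | hl
    · simp at hf; omega
    rcases Nat.eq_zero_or_pos l' with rfl | hl'
    · simp at hh; omega
    rcases le_total l l' with hle | hle
    · obtain ⟨d, rfl⟩ := Nat.exists_eq_add_of_le hle
      push_cast at hb2 hh
      -- As in Euclid's algorithm: either the first `l` steps of `h` do no harm and are used, or
      -- they lose height and are cut off, keeping an increment of at least `r`.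
      by_cases hδ : 0 ≤ h (b + l) - h b
      · exact ⟨l, a, b, ha1, ha2, hb1, by omega, by omega⟩
      · refine ih (l + d) (by omega) l d rfl ha1 ha2 (b := b + l) (by omega) (by omega) hf ?_
        rw [add_assoc]
        omega
    · obtain ⟨d, rfl⟩ := Nat.exists_eq_add_of_le hle
      push_cast at ha2 hf
      by_cases hδ : 0 ≤ f (a + l') - f a
      · exact ⟨l', a, b, ha1, by omega, hb1, hb2, by omega⟩
      · refine ih (d + l') (by omega) d l' rfl (a := a + l') (by omega) (by omega) hb1 hb2 ?_ hh
        rw [add_assoc]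
        omega

/-- In a proper colouring of a grid, the increments of the heights in two rows are close. -/
theorem abs_height_rows_le {c : ℤ → ℤ → Fin 3} {m : ℤ}
    (hx : ∀ x y, 0 ≤ x → x + 1 < m → 0 ≤ y → y < m → c x y ≠ c (x + 1) y)
    (hy : ∀ x y, 0 ≤ x → x < m → 0 ≤ y → y + 1 < m → c x y ≠ c x (y + 1))
    {x₁ x₂ : ℤ} (h₁ : 0 ≤ x₁) (h₁' : x₁ < m) (h₂ : 0 ≤ x₂) (h₂' : x₂ < m) (n : ℕ) (hn : n < m) :
    |(height (c · n) x₂ - height (c · n) x₁) - (height (c · 0) x₂ - height (c · 0) x₁)| ≤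
      2 * n := by
  induction n with
  | zero => simp
  | succ n ih =>
    have ih := ih (by push_cast at hn; omega)
    -- The two routes from `(0, n)` to `(x, n + 1)` have equal increments. The first step is there
    -- because each row is normalised at column `0`.
    have key : ∀ x, 0 ≤ x → x < m → step (c 0 n) (c 0 (n + 1)) + height (c · (n + 1)) x =
        height (c · n) x + step (c x n) (c x (n + 1)) := by
      intro x hx0
      induction x, hx0 using Int.leInduction with
      | base => intro _; simp [height]
      | succ x hx0 ihx =>
        intro hxm
        have ihx := ihx (by omega)
        push_cast at hn
        rw [height_succ _ hx0, height_succ _ hx0]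
        have := step_square (hx x n hx0 hxm (by omega) (by omega))
          (hy (x + 1) n (by omega) hxm (by omega) (by omega))
          (hy x n hx0 (by omega) (by omega) (by omega))
          (hx x (n + 1) hx0 hxm (by omega) (by omega))
        omega
    have k1 := key x₁ h₁ h₁'
    have k2 := key x₂ h₂ h₂'
    have s1 := abs_step (c x₁ n) (c x₁ (n + 1))
    have s2 := abs_step (c x₂ n) (c x₂ (n + 1))
    push_cast
    grind

/-! ### The family of inputs -/

/-- The choices of the adversary: for each level whether the reflections of that level are
performed, and for both halves of the grid the final placement of the columns. -/
abbrev Choice := (ℕ → Bool) × (Bool → Bool × ℕ)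

/-- The arrangement of the columns in one half of the grid. -/
noncomputable def columns (T k : ℕ) (s : Choice) (h : Bool) : Equiv.Perm ℤ :=
  place (tile (T + 1) k k) (s.2 h).1 (s.2 h).2 * arrange (T + 1) k s.1 k

/-- The half of the grid to which a row belongs. -/
def halfOf (T : ℕ) (y : ℤ) : Bool := decide (y < T + 2)

/-- The row in which the algorithm has to work first, in both halves of the grid. -/
def mainRow (T : ℕ) (h : Bool) : ℤ := if h then 0 else 2 * T + 3

variable {m T k : ℕ} (K : Coordinates m)

/-- The actual position of a node. -/
noncomputable def position (T k : ℕ) (s : Choice) (u : Fin (m ^ 2)) : ℤ × ℤ :=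
  (columns T k s (halfOf T (K.coord u).2) (K.coord u).1, (K.coord u).2)

/-- The nodes that are presented in the stages up to `j`. -/
def early (T k j : ℕ) : Set (Fin (m ^ 2)) :=
  {u | ∃ h, ∃ p ∈ Set.Ico (0 : ℤ) (2 ^ (k - j)), (K.coord u).2 = mainRow T h ∧
    (K.coord u).1 ∈ slot (T + 1) k j p}

theorem halfOf_mainRow (T : ℕ) (h : Bool) : halfOf T (mainRow T h) = h := by
  cases h
  · simp [halfOf, mainRow]; omega
  · simp [halfOf, mainRow]; omega

/-- The radius `T + 1`, not `T`, also covers the neighbours of visible nodes; the two bands end at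
row `T + 1` and start at row `T + 2`. -/
theorem halfOf_eq {T : ℕ} {h : Bool} {y : ℤ} (hy : |y - mainRow T h| ≤ T + 1) :
    halfOf T y = h := by
  rw [abs_le] at hy
  cases h
  · simp only [mainRow, Bool.false_eq_true, ↓reduceIte] at hy
    simp only [halfOf, decide_eq_false_iff_not]
    omega
  · simp only [mainRow, ↓reduceIte] at hy
    simp only [halfOf, decide_eq_true_eq]
    omega

theorem mainRow_mem (h : Bool) (hm : 2 * T + 3 < m) : mainRow T h ∈ Set.Ico (0 : ℤ) m := by
  cases h
  · simp only [mainRow, Bool.false_eq_true, ↓reduceIte, Set.mem_Ico]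
    omega
  · simp only [mainRow, ↓reduceIte, Set.mem_Ico]
    omega

theorem position_injective (s : Choice) : Function.Injective (position K T k s) := by
  intro u v h
  simp only [position, Prod.mk.injEq] at h
  obtain ⟨h1, h2⟩ := h
  rw [h2] at h1
  exact K.injective (Prod.ext ((columns T k s _).injective h1) h2)

theorem columns_mem_Ico {s : Choice} (hs : ∀ h, ((s.2 h).2 : ℤ) ≤ tile (T + 1) k k)
    (hm : 2 * tile (T + 1) k k ≤ m) (h : Bool) {x : ℤ} (hx : x ∈ Set.Ico (0 : ℤ) m) :
    columns T k s h x ∈ Set.Ico (0 : ℤ) m := by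
  have := tile_pos (T + 1) k k
  have := hs h
  exact place_mem_Ico _ (by omega) (arrange_mem_Ico le_rfl (by omega) hx)

theorem gridOf_position_mem {s : Choice} (hs : ∀ h, ((s.2 h).2 : ℤ) ≤ tile (T + 1) k k)
    (hm : 2 * tile (T + 1) k k ≤ m) : gridOf (position K T k s) ∈ squareGrids (m ^ 2) :=
  gridOf_mem_squareGrids (position_injective K s)
    (fun u => columns_mem_Ico hs hm _ (K.fst_mem u)) fun u => K.snd_mem u

theorem slot_eq (g k j : ℕ) (p : ℤ) : slot g k j p =
    Set.Ico (p * tile g k j + (k - j) * g + g) ((p + 1) * tile g k j - (k - j) * g - g) := by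
  have e : ((k : ℤ) + 1 - j) * g = (k - j) * g + g := by ring
  rw [slot, shrunk, e, add_assoc, sub_sub]

/-- `Q` and `Q'` are two continuations after a common stage, `z` is a presented node, `a` is visible
from it and `b` is a potential neighbour of `a`. The margin `T + 1` keeps all three where both
continuations are rigid. -/
theorem abs_sub_eq_of_near {Q Q' : Equiv.Perm ℤ} {A B : ℤ} (hQ : AffOn Q (Set.Ico A B))
    (hQ' : AffOn Q' (Set.Ico A B)) {a b z : ℤ} (hz1 : A + ((T : ℤ) + 1) ≤ z)
    (hz2 : z < B - ((T : ℤ) + 1)) (ha : |Q a - Q z| ≤ T)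
    (hb : |Q a - Q b| ≤ 1 ∨ |Q' a - Q' b| ≤ 1) : |Q a - Q b| = |Q' a - Q' b| := by
  have ha1 : a ∈ Set.Ico A B :=
    hQ.mem_of_abs_le (d := T) Q.injective (by omega) (by omega) ha
  have ha2 : |a - z| ≤ T := by
    rwa [← hQ.abs_sub (z := z) ⟨by omega, by omega⟩ ha1]
  rw [abs_le] at ha2
  have hb1 : b ∈ Set.Ico A B := by
    rcases hb with hb | hb
    · rw [abs_sub_comm] at hb
      exact hQ.mem_of_abs_le (d := 1) Q.injective (by omega) (by omega) hb
    · rw [abs_sub_comm] at hb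
      exact hQ'.mem_of_abs_le (d := 1) Q'.injective (by omega) (by omega) hb
  rw [hQ.abs_sub hb1 ha1, hQ'.abs_sub hb1 ha1]

/-- The surroundings of the nodes of stage `j` depend only on the first `j` bits. -/
theorem adj_position_iff {s s' : Choice} {j : ℕ} (hj : j ≤ k) (hs : ∀ i < j, s.1 i = s'.1 i)
    {u w : Fin (m ^ 2)} (hu : u ∈ early K T k j)
    (hw : w ∈ nbhd (gridOf (position K T k s)) T u) (v : Fin (m ^ 2)) :
    (gridOf (position K T k s)).Adj w v ↔ (gridOf (position K T k s')).Adj w v := by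
  obtain ⟨h, p, hp, hy, hx⟩ := hu
  obtain ⟨hw1, hw2⟩ := abs_le_of_mem_nbhd_gridOf hw
  simp only [position] at hw1 hw2
  rw [hy] at hw1 hw2
  rw [halfOf_mainRow, halfOf_eq (h := h) (by omega)] at hw1
  simp only [gridOf_adj, position]
  -- Nodes more than one row apart are adjacent in neither grid; otherwise `v` moves with the same
  -- half as `w`.
  by_cases hv : |(K.coord w).2 - (K.coord v).2| ≤ 1
  · have hv' : halfOf T (K.coord v).2 = h := by
      apply halfOf_eq
      rw [abs_le] at *
      constructor <;> omega
    rw [hv', halfOf_eq (h := h) (y := (K.coord w).2) (by omega)]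
    obtain ⟨Q, hQ, hA⟩ := exists_affOn_mul_arrange (g := T + 1) (k := k) s.1
      (affOn_place (tile (T + 1) k k) (s.2 h).1 (s.2 h).2) hj
    obtain ⟨Q', hQ', hA'⟩ := exists_affOn_mul_arrange (g := T + 1) (k := k) s'.1
      (affOn_place (tile (T + 1) k k) (s'.2 h).1 (s'.2 h).2) hj
    rw [← arrange_congr hs] at hQ'
    simp only [columns, hQ, hQ', Equiv.Perm.mul_apply] at hw1 ⊢
    rw [← arrange_mem_slot (b := s.1) le_rfl hj, slot_eq] at hx
    have hx1 := hx.1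
    have hx2 := hx.2
    push_cast at hx1 hx2
    have hAp := hA p hp
    have hAp' := hA' p hp
    simp only [zone, shrunk] at hAp hAp'
    push_cast at hAp hAp'
    have key := abs_sub_eq_of_near (b := arrange (T + 1) k s.1 j (K.coord v).1) hAp hAp' hx1 hx2 hw1
    have n0 := abs_nonneg ((K.coord w).2 - (K.coord v).2)
    constructor
    · intro hadj
      rw [← key (Or.inl (by omega))]
      exact hadj
    · intro hadj
      rw [key (Or.inr (by omega))]
      exact hadj
  · constructor
    · intro hadj
      have := abs_nonneg (columns T k s (halfOf T (K.coord w).2) (K.coord w).1 -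
        columns T k s (halfOf T (K.coord v).2) (K.coord v).1)
      omega
    · intro hadj
      have := abs_nonneg (columns T k s' (halfOf T (K.coord w).2) (K.coord w).1 -
        columns T k s' (halfOf T (K.coord v).2) (K.coord v).1)
      omega

theorem early_mono {i j : ℕ} (hij : i ≤ j) (hj : j ≤ k) : early K T k i ⊆ early K T k j := by
  induction j, hij using Nat.le_induction with
  | base => exact subset_rfl
  | succ j hij ih =>
    refine (ih (by omega)).trans ?_
    rintro u ⟨h, p, hp, hy, hx⟩
    exact ⟨h, p / 2, half_mem_Ico (by omega) hp, hy,
      zone_subset_slot p (by omega) (slot_subset_zone p hx)⟩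

/-- The stages are sets of node names, independent of positions, so one order serves all algorithms
and all choices, as an oblivious adversary requires. -/
theorem exists_order (T k : ℕ) : ∃ σ : Equiv.Perm (Fin (m ^ 2)),
    ∀ (A : DetAlgorithm (m ^ 2) (Fin 3)), ∀ j ≤ k, ∀ s s' : Choice, (∀ i < j, s.1 i = s'.1 i) →
      ∀ u ∈ early K T k j, output A (gridOf (position K T k s)) T σ u =
        output A (gridOf (position K T k s')) T σ u := by
  obtain ⟨σ, hσ⟩ := exists_perm_initial k (early K T k) fun i j => early_mono K
  exact ⟨σ, fun A j hj s s' hs u hu => output_congr A (hσ j hj)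
    (fun u hu w hw v => adj_position_iff K hj hs hu hw v) hu⟩

/-! ### Forcing a large spread -/

/-- The colours of the main rows, arranged as they are after `j` levels. -/
noncomputable def stageColor (T k : ℕ) (col : Choice → Fin (m ^ 2) → Fin 3) (s : Choice) (j : ℕ)
    (h : Bool) (z : ℤ) : Fin 3 :=
  col s (K.node ((arrange (T + 1) k s.1 j).symm z) (mainRow T h))

theorem symm_arrange_mem_slot {g : ℕ} {b : ℕ → Bool} {i j : ℕ} {p z : ℤ} (hij : i ≤ j)
    (hj : j ≤ k) (hz : z ∈ slot g k j p) : (arrange g k b i).symm z ∈ slot g k j p := by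
  rw [← arrange_mem_slot (b := b) hij hj, Equiv.apply_symm_apply]
  exact hz

theorem slot_subset_Ico {g j : ℕ} {p : ℤ} (hj : j ≤ k) (hp : p ∈ Set.Ico 0 (2 ^ (k - j))) :
    slot g k j p ⊆ Set.Ico 0 (tile g k k) :=
  (slot_subset_zone p).trans (zone_subset_Ico hj hp)

section

variable {K} {col : Choice → Fin (m ^ 2) → Fin 3}

/-- The levels before `j` preserve the slots of level `j`, which transfers locality from nodes to
positions. -/
theorem stageColor_congr (hm : 2 * tile (T + 1) k k ≤ m) (hmT : 2 * T + 3 < m)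
    (hloc : ∀ j ≤ k, ∀ s s' : Choice, (∀ i < j, s.1 i = s'.1 i) →
      ∀ u ∈ early K T k j, col s u = col s' u)
    {j : ℕ} (hj : j ≤ k) {s s' : Choice} (hs : ∀ i < j, s.1 i = s'.1 i) {p z : ℤ}
    (hp : p ∈ Set.Ico 0 (2 ^ (k - j))) (hz : z ∈ slot (T + 1) k j p) (h : Bool) :
    stageColor K T k col s j h z = stageColor K T k col s' j h z := by
  have hx := symm_arrange_mem_slot (b := s.1) le_rfl hj hz
  have hx' := slot_subset_Ico hj hp hx
  have ht := tile_pos (T + 1) k k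
  have hc := K.coord_node _ ⟨hx'.1, hx'.2.trans_le (by omega)⟩ _ (mainRow_mem h hmT)
  rw [stageColor, stageColor, ← arrange_congr hs]
  refine hloc j hj s s' hs _ ⟨h, p, hp, ?_, ?_⟩
  · rw [hc]
  · rwa [hc]

theorem stageColor_ne (hm : 2 * tile (T + 1) k k ≤ m) (hmT : 2 * T + 3 < m) {s : Choice}
    (hproper : IsProper (gridOf (position K T k s)) (col s))
    {j : ℕ} (hj : j ≤ k) {p z : ℤ} (hp : p ∈ Set.Ico 0 (2 ^ (k - j)))
    (hz : z ∈ slot (T + 1) k j p) (hz' : z + 1 ∈ slot (T + 1) k j p) (h : Bool) :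
    stageColor K T k col s j h z ≠ stageColor K T k col s j h (z + 1) := by
  have ht := tile_pos (T + 1) k k
  have hx := slot_subset_Ico hj hp (symm_arrange_mem_slot (b := s.1) le_rfl hj hz)
  have hx' := slot_subset_Ico hj hp (symm_arrange_mem_slot (b := s.1) le_rfl hj hz')
  apply hproper
  rw [gridOf_adj]
  simp only [position]
  rw [K.coord_node _ ⟨hx.1, hx.2.trans_le (by omega)⟩ _ (mainRow_mem h hmT),
    K.coord_node _ ⟨hx'.1, hx'.2.trans_le (by omega)⟩ _ (mainRow_mem h hmT), halfOf_mainRow]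
  obtain ⟨Q, hQ, hA⟩ := exists_affOn_mul_arrange (g := T + 1) (k := k) s.1
    (affOn_place (tile (T + 1) k k) (s.2 h).1 (s.2 h).2) hj
  simp only [columns, hQ, Equiv.Perm.mul_apply, Equiv.apply_symm_apply]
  rw [(hA p hp).abs_sub (slot_subset_zone p hz') (slot_subset_zone p hz)]
  simp

/-- The summand `2 * (k + 1) * g` of the tile length pays for the widest margins, those of level
`0`; the summand `2` is what remains. -/
theorem slot_nonempty {g j : ℕ} {p : ℤ} :
    p * tile g k j + ((k : ℤ) + 1 - j) * g < (p + 1) * tile g k j - ((k : ℤ) + 1 - j) * g := by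
  have h1 : 2 * ((k : ℤ) + 1) * g + 2 ≤ tile g k j := by
    unfold tile
    exact le_mul_of_one_le_left (by positivity) (one_le_pow₀ (by norm_num))
  have h2 : 0 ≤ (j : ℤ) * g := by positivity
  nlinarith

/-- The trivial final placement. -/
def basePlacement : Bool → Bool × ℕ := fun _ => (false, 0)

/-- The sum of the weights `2 ^ (-spread)` of all slots of level `j`. -/
noncomputable def weight (K : Coordinates m) (T k : ℕ) (col : Choice → Fin (m ^ 2) → Fin 3)
    (b : ℕ → Bool) (j : ℕ) : ℝ :=
  ∑ h : Bool, ∑ p ∈ Finset.range (2 ^ (k - j)),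
    (1 / 2 : ℝ) ^ spread (stageColor K T k col (b, basePlacement) j h)
      (p * tile (T + 1) k j + ((k : ℤ) + 1 - j) * (T + 1 : ℕ))
      ((p + 1) * tile (T + 1) k j - ((k : ℤ) + 1 - j) * (T + 1 : ℕ))

theorem sum_range_two_mul (f : ℕ → ℝ) (n : ℕ) :
    ∑ i ∈ Finset.range (2 * n), f i = ∑ i ∈ Finset.range n, (f (2 * i) + f (2 * i + 1)) := by
  induction n with
  | zero => simp
  | succ n ih =>
    rw [Nat.mul_succ, Finset.sum_range_succ, Finset.sum_range_succ, ih, Finset.sum_range_succ]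
    ring

/-- The bound of `merge_weights` is summed over all pairs in both halves before the better value of
the common bit is chosen. -/
theorem exists_weight_succ_le (hm : 2 * tile (T + 1) k k ≤ m) (hmT : 2 * T + 3 < m)
    (hloc : ∀ j ≤ k, ∀ s s' : Choice, (∀ i < j, s.1 i = s'.1 i) →
      ∀ u ∈ early K T k j, col s u = col s' u)
    (hproper : ∀ b, IsProper (gridOf (position K T k (b, basePlacement))) (col (b, basePlacement)))
    {j : ℕ} (hj : j < k) (b : ℕ → Bool) :
    ∃ b' : ℕ → Bool, weight K T k col b' (j + 1) ≤ 3 / 8 * weight K T k col b j := by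
  let b₀ := Function.update b j false
  let b₁ := Function.update b j true
  have hb₀ : ∀ i < j, b i = b₀ i := fun i hi => (Function.update_of_ne hi.ne _ _).symm
  have hb₁ : ∀ i < j, b i = b₁ i := fun i hi => (Function.update_of_ne hi.ne _ _).symm
  have hb₀j : b₀ j = false := Function.update_self ..
  have hb₁j : b₁ j = true := Function.update_self ..
  suffices H : weight K T k col b₀ (j + 1) + weight K T k col b₁ (j + 1) ≤
      3 / 4 * weight K T k col b j by
    by_cases h : weight K T k col b₀ (j + 1) ≤ 3 / 8 * weight K T k col b j
    · exact ⟨b₀, h⟩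
    · exact ⟨b₁, by linarith⟩
  have hk : 2 ^ (k - j) = 2 * 2 ^ (k - (j + 1)) := by
    rw [← pow_succ']; congr 1; omega
  simp only [weight]
  rw [← Finset.sum_add_distrib, Finset.mul_sum]
  refine Finset.sum_le_sum fun h _ => ?_
  rw [hk, sum_range_two_mul, ← Finset.sum_add_distrib, Finset.mul_sum]
  refine Finset.sum_le_sum fun p hp => ?_
  rw [Finset.mem_range] at hp
  have hp2 : (p : ℤ) < 2 ^ (k - (j + 1)) := by exact_mod_cast hp
  have hkz : (2 : ℤ) ^ (k - j) = 2 * 2 ^ (k - (j + 1)) := by exact_mod_cast hk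
  have hpe : ((2 * p : ℕ) : ℤ) ∈ Set.Ico (0 : ℤ) (2 ^ (k - j)) := by
    rw [hkz]; constructor <;> push_cast <;> omega
  have hpo : ((2 * p + 1 : ℕ) : ℤ) ∈ Set.Ico (0 : ℤ) (2 ^ (k - j)) := by
    rw [hkz]; constructor <;> push_cast <;> omega
  have hpp : (p : ℤ) ∈ Set.Ico (0 : ℤ) (2 ^ (k - (j + 1))) := ⟨by omega, hp2⟩
  have hsub : ∀ q : ℤ, q / 2 = p → slot (T + 1) k j q ⊆ slot (T + 1) k (j + 1) p := fun q hq =>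
    hq ▸ (slot_subset_zone q).trans (zone_subset_slot q hj)
  have hflip0 : ∀ z, stageColor K T k col (b₀, basePlacement) (j + 1) h z =
      stageColor K T k col (b₀, basePlacement) j h z := fun z => by
    simp only [stageColor, arrange_succ_of_false hb₀j]
  have hflip1 : ∀ z, stageColor K T k col (b₁, basePlacement) (j + 1) h (flipFun (T + 1) k j z) =
      stageColor K T k col (b₁, basePlacement) j h z := fun z => by
    simp only [stageColor]
    congr 2
    rw [Equiv.symm_apply_eq, arrange_succ_apply_of_true hj.le hb₁j, Equiv.apply_symm_apply]
  refine merge_weights (f := stageColor K T k col (b, basePlacement) j h)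
    (c := (2 * ((2 * p + 1 : ℕ) : ℤ) + 1) * tile (T + 1) k j - 1) ?_ slot_nonempty
    slot_nonempty ?_ (hsub _ (by omega)) (hsub _ (by omega)) ?_ ?_ ?_ ?_ ?_ ?_ ?_
  · exact (slot_subset_Ico hj hpp ⟨le_rfl, slot_nonempty⟩).1
  · have := (even_tile (T + 1) k j).mul_left (2 * ((2 * p + 1 : ℕ) : ℤ) + 1)
    exact this.sub_odd odd_one
  · exact fun z hz hz' => stageColor_ne hm hmT (hproper b) hj.le hpe hz hz' h
  · exact fun z hz hz' => stageColor_ne hm hmT (hproper b) hj.le hpo hz hz' h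
  · intro z hz
    rw [hflip0]
    exact (stageColor_congr hm hmT hloc hj.le hb₀ hpe hz h).symm
  · intro z hz
    rw [hflip0]
    exact (stageColor_congr hm hmT hloc hj.le hb₀ hpo hz h).symm
  · intro z hz
    rw [stageColor_congr hm hmT hloc hj.le (s' := (b₁, basePlacement)) hb₁ hpe hz h, ← hflip1,
      flipFun_of_even hj.le (p := (2 * p : ℕ)) (by simp) (slot_subset_zone _ hz)]
  · exact fun z hz => reflect_mem_shrunk hz
  · intro z hz
    rw [stageColor_congr hm hmT hloc hj.le (s' := (b₁, basePlacement)) hb₁ hpo hz h, ← hflip1,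
      flipFun_of_odd hj.le hpo (by simp) (slot_subset_zone _ hz)]

theorem exists_weight_le (hm : 2 * tile (T + 1) k k ≤ m) (hmT : 2 * T + 3 < m)
    (hloc : ∀ j ≤ k, ∀ s s' : Choice, (∀ i < j, s.1 i = s'.1 i) →
      ∀ u ∈ early K T k j, col s u = col s' u)
    (hproper : ∀ b, IsProper (gridOf (position K T k (b, basePlacement))) (col (b, basePlacement)))
    {j : ℕ} (hj : j ≤ k) :
    ∃ b : ℕ → Bool, weight K T k col b j ≤ (3 / 8) ^ j * 2 ^ (k + 1) := by
  induction j with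
  | zero =>
    refine ⟨fun _ => false, ?_⟩
    calc weight K T k col (fun _ => false) 0
        ≤ ∑ _h : Bool, ∑ _p ∈ Finset.range (2 ^ (k - 0)), (1 : ℝ) :=
          Finset.sum_le_sum fun h _ => Finset.sum_le_sum fun p _ =>
            pow_le_one₀ (by norm_num) (by norm_num)
      _ = (3 / 8) ^ 0 * 2 ^ (k + 1) := by simp [pow_succ']
  | succ j ih =>
    obtain ⟨b, hb⟩ := ih (by omega)
    obtain ⟨b', hb'⟩ := exists_weight_succ_le hm hmT hloc hproper (show j < k by omega) b
    refine ⟨b', hb'.trans ?_⟩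
    rw [pow_succ]
    linarith

/-- Some choice of bits makes the spread of both main rows large. -/
theorem exists_le_spread {r : ℕ} (hr : 0 < r) (hk : k = 3 * r)
    (hm : 2 * tile (T + 1) k k ≤ m) (hmT : 2 * T + 3 < m)
    (hloc : ∀ j ≤ k, ∀ s s' : Choice, (∀ i < j, s.1 i = s'.1 i) →
      ∀ u ∈ early K T k j, col s u = col s' u)
    (hproper : ∀ b, IsProper (gridOf (position K T k (b, basePlacement)))
      (col (b, basePlacement))) :
    ∃ b : ℕ → Bool, ∀ h, r ≤ spread (stageColor K T k col (b, basePlacement) k h)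
      (T + 1) (tile (T + 1) k k - (T + 1)) := by
  obtain ⟨b, hb⟩ := exists_weight_le hm hmT hloc hproper le_rfl
  refine ⟨b, fun h => ?_⟩
  by_contra! hlt
  have h1 : (1 / 2 : ℝ) ^ spread (stageColor K T k col (b, basePlacement) k h)
      (T + 1) (tile (T + 1) k k - (T + 1)) ≤ weight K T k col b k := by
    have e : weight K T k col b k = ∑ h : Bool,
        (1 / 2 : ℝ) ^ spread (stageColor K T k col (b, basePlacement) k h)
          (T + 1) (tile (T + 1) k k - (T + 1)) := by
      simp [weight]
    rw [e]
    exact Finset.single_le_sum (f := fun h => (1 / 2 : ℝ) ^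
      spread (stageColor K T k col (b, basePlacement) k h) (T + 1) (tile (T + 1) k k - (T + 1)))
      (fun _ _ => by positivity) (Finset.mem_univ h)
  have h2 : (1 / 2 : ℝ) ^ (r - 1) ≤ (1 / 2 : ℝ) ^
      spread (stageColor K T k col (b, basePlacement) k h) (T + 1) (tile (T + 1) k k - (T + 1)) :=
    pow_le_pow_of_le_one (by norm_num) (by norm_num) (by omega)
  -- Three levels gain one unit of spread because `(3 / 4) ^ 3 = 27 / 64 < 1 / 2`.
  have h3 : (3 / 8 : ℝ) ^ k * 2 ^ (k + 1) = 2 * (27 / 64) ^ r := by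
    rw [pow_succ, ← mul_assoc, ← mul_pow, hk, pow_mul]
    norm_num [mul_comm]
  have h4 : (1 / 2 : ℝ) ^ r = 1 / 2 * (1 / 2 : ℝ) ^ (r - 1) := by
    rw [← pow_succ', Nat.sub_add_cancel hr]
  have h5 : (27 / 64 : ℝ) ^ r < (1 / 2) ^ r :=
    pow_lt_pow_left₀ (by norm_num) (by norm_num) hr.ne'
  linarith

/-! ### The contradiction -/

/-- The colours by position. -/
noncomputable def gridColor (K : Coordinates m) (T k : ℕ) (col : Choice → Fin (m ^ 2) → Fin 3)
    (s : Choice) (x y : ℤ) : Fin 3 :=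
  col s (K.node ((columns T k s (halfOf T y)).symm x) y)

/-- An injective self-map of a finite interval is onto. -/
theorem symm_columns_mem_Ico {s : Choice} (hs : ∀ h, ((s.2 h).2 : ℤ) ≤ tile (T + 1) k k)
    (hm : 2 * tile (T + 1) k k ≤ m) (h : Bool) {x : ℤ} (hx : x ∈ Set.Ico (0 : ℤ) m) :
    (columns T k s h).symm x ∈ Set.Ico (0 : ℤ) m := by
  have hmaps : Set.MapsTo (columns T k s h) (Finset.Ico (0 : ℤ) m) (Finset.Ico (0 : ℤ) m) := by
    rw [Finset.coe_Ico]
    exact fun x hx => columns_mem_Ico hs hm h hx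
  rw [← Finset.coe_Ico] at hx ⊢
  obtain ⟨y, hy, rfl⟩ := Finset.surjOn_of_injOn_of_card_le _ hmaps
    (columns T k s h).injective.injOn le_rfl hx
  rwa [Equiv.symm_apply_apply]

theorem gridColor_ne {s : Choice} (hs : ∀ h, ((s.2 h).2 : ℤ) ≤ tile (T + 1) k k)
    (hm : 2 * tile (T + 1) k k ≤ m)
    (hproper : IsProper (gridOf (position K T k s)) (col s)) {x y x' y' : ℤ}
    (hx : x ∈ Set.Ico (0 : ℤ) m) (hy : y ∈ Set.Ico (0 : ℤ) m)
    (hx' : x' ∈ Set.Ico (0 : ℤ) m) (hy' : y' ∈ Set.Ico (0 : ℤ) m) (h : |x - x'| + |y - y'| = 1) :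
    gridColor K T k col s x y ≠ gridColor K T k col s x' y' := by
  apply hproper
  rw [gridOf_adj]
  simp only [position]
  rw [K.coord_node _ (symm_columns_mem_Ico hs hm _ hx) _ hy,
    K.coord_node _ (symm_columns_mem_Ico hs hm _ hx') _ hy']
  simpa using h

theorem gridColor_place (s : Choice) (h : Bool) (z : ℤ) :
    gridColor K T k col s (place (tile (T + 1) k k) (s.2 h).1 (s.2 h).2 z) (mainRow T h) =
      stageColor K T k col s k h z := by
  simp only [gridColor, stageColor, halfOf_mainRow]
  congr 2
  rw [Equiv.symm_apply_eq, columns, Equiv.Perm.mul_apply, Equiv.apply_symm_apply]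

/-- The sign records whether the height rises or falls from left to right. -/
theorem exists_increasing {f : ℤ → Fin 3} {a b : ℤ} {r : ℕ} (hab : a < b) (h : r ≤ spread f a b) :
    ∃ ε : ℤ, (ε = 1 ∨ ε = -1) ∧ ∃ (u : ℤ) (l : ℕ), a ≤ u ∧ u + l < b ∧
      r ≤ ε * height f (u + l) - ε * height f u := by
  obtain ⟨u, hu, v, hv, huv⟩ := exists_spread_eq f hab
  have hu1 := hu.1
  have hu2 := hu.2
  have hv1 := hv.1
  have hv2 := hv.2
  rcases le_total u v with hle | hle
  · refine ⟨1, Or.inl rfl, u, (v - u).toNat, hu1, by omega, ?_⟩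
    rw [show u + ((v - u).toNat : ℤ) = v by omega]
    omega
  · refine ⟨-1, Or.inr rfl, v, (u - v).toNat, hv1, by omega, ?_⟩
    rw [show v + ((u - v).toNat : ℤ) = u by omega]
    omega

/-- Labellings that depend only on the revealed bits cannot all be proper. -/
theorem not_forall_isProper (hk : k = 3 * (4 * T + 7)) (hm : 2 * tile (T + 1) k k ≤ m)
    (hmT : 2 * T + 3 < m)
    (hloc : ∀ j ≤ k, ∀ s s' : Choice, (∀ i < j, s.1 i = s'.1 i) →
      ∀ u ∈ early K T k j, col s u = col s' u) :
    ∃ s : Choice, (∀ h, ((s.2 h).2 : ℤ) ≤ tile (T + 1) k k) ∧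
      ¬ IsProper (gridOf (position K T k s)) (col s) := by
  by_contra! hproper
  have ht := tile_pos (T + 1) k k
  have hbase : ∀ b : ℕ → Bool, ∀ h, ((((b, basePlacement) : Choice).2 h).2 : ℤ) ≤
      tile (T + 1) k k := fun b h => by simp [basePlacement, ht.le]
  have hpb := fun b : ℕ → Bool => hproper (b, basePlacement) (hbase b)
  -- The spread `4 * T + 7` is one more than the two main rows may differ by, `2 * (2 * T + 3)`.
  obtain ⟨b, hb⟩ := exists_le_spread (by omega) hk hm hmT hloc hpb
  have h0 : (0 : ℤ) ∈ Set.Ico (0 : ℤ) (2 ^ (k - k)) := by simp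
  have hslot : slot (T + 1) k k 0 = Set.Ico ((T : ℤ) + 1) (tile (T + 1) k k - (T + 1)) := by
    rw [slot_eq]; push_cast; simp
  have hlt : (T : ℤ) + 1 < tile (T + 1) k k - (T + 1) := by
    have := slot_nonempty (g := T + 1) (k := k) (j := k) (p := 0)
    push_cast at this
    simp only [zero_mul, zero_add, one_mul] at this
    linarith
  obtain ⟨ε, hε, u, l, hu, hul, hinc⟩ := exists_increasing hlt (hb true)
  obtain ⟨ε', hε', u', l', hu', hul', hinc'⟩ := exists_increasing hlt (hb false)
  obtain ⟨n, a, a', ha, han, ha', han', hsum⟩ := exists_common_length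
    (f := fun z => ε * height (stageColor K T k col (b, basePlacement) k true) z)
    (h := fun z => ε' * height (stageColor K T k col (b, basePlacement) k false) z)
    (by positivity) l l' hu hul hu' hul' hinc hinc'
  -- the increments of the heights are the same in the final position
  have htrans : ∀ θ : Bool → Bool × ℕ, (∀ h, ((θ h).2 : ℤ) ≤ tile (T + 1) k k) → ∀ h : Bool,
      ∀ z ∈ slot (T + 1) k k 0, ∀ z' ∈ slot (T + 1) k k 0,
      height (gridColor K T k col (b, θ) · (mainRow T h))
          (place (tile (T + 1) k k) (θ h).1 (θ h).2 z') -
        height (gridColor K T k col (b, θ) · (mainRow T h))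
          (place (tile (T + 1) k k) (θ h).1 (θ h).2 z) =
      height (stageColor K T k col (b, basePlacement) k h) z' -
        height (stageColor K T k col (b, basePlacement) k h) z := by
    intro θ hθ h z hz z' hz'
    obtain ⟨δ, c, hδ, haff⟩ := affOn_place (tile (T + 1) k k) (θ h).1 (θ h).2
    have hsub := slot_subset_Ico (g := T + 1) le_rfl h0
    rw [hslot] at hz hz' hsub
    refine height_sub_height_of_affine (by positivity) hδ (fun z hz => haff z (hsub hz))
      (fun z hz => ?_) ?_ ?_ hz hz'
    · have hz0 := hsub hz
      have := hθ h
      exact (place_mem_Ico (m := 2 * tile (T + 1) k k) _ (by omega)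
        ⟨hz0.1, by have := hz0.2; omega⟩).1
    · intro z hz hz'
      rw [← hslot] at hz hz'
      exact stageColor_ne hm hmT (hpb b) le_rfl h0 hz hz' h
    · intro z hz
      rw [← hslot] at hz
      rw [gridColor_place ((b, θ) : Choice) h z]
      exact stageColor_congr hm hmT hloc le_rfl (s := (b, θ)) (s' := (b, basePlacement))
        (fun _ _ => rfl) h0 hz h
  have hrows : ∀ θ : Bool → Bool × ℕ, (∀ h, ((θ h).2 : ℤ) ≤ tile (T + 1) k k) →
      ∀ x₁ x₂ : ℤ, 0 ≤ x₁ → x₁ < m → 0 ≤ x₂ → x₂ < m →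
      |(height (gridColor K T k col (b, θ) · (mainRow T false)) x₂ -
        height (gridColor K T k col (b, θ) · (mainRow T false)) x₁) -
        (height (gridColor K T k col (b, θ) · (mainRow T true)) x₂ -
        height (gridColor K T k col (b, θ) · (mainRow T true)) x₁)| ≤ 4 * T + 6 := by
    intro θ hθ x₁ x₂ h1 h1' h2 h2'
    have := abs_height_rows_le (c := gridColor K T k col (b, θ)) (m := m)
      (fun x y hx hx' hy hy' => gridColor_ne hθ hm (hproper _ hθ) ⟨hx, by omega⟩ ⟨hy, hy'⟩
        ⟨by omega, hx'⟩ ⟨hy, hy'⟩ (by simp))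
      (fun x y hx hx' hy hy' => gridColor_ne hθ hm (hproper _ hθ) ⟨hx, hx'⟩ ⟨hy, by omega⟩
        ⟨hx, hx'⟩ ⟨by omega, hy'⟩ (by simp)) h1 h1' h2 h2' (2 * T + 3) (by omega)
    push_cast at this
    simp only [mainRow, Bool.false_eq_true, ↓reduceIte]
    linarith
  have ms : ∀ z, (T : ℤ) + 1 ≤ z → z < tile (T + 1) k k - (T + 1) → z ∈ slot (T + 1) k k 0 :=
    fun z h1 h2 => hslot ▸ ⟨h1, h2⟩
  have m1 := ms a ha (by omega)
  have m2 := ms (a + n) (by omega) han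
  have m3 := ms a' ha' (by omega)
  have m4 := ms (a' + n) (by omega) han'
  push_cast at hsum
  by_cases hεε : ε = ε'
  · -- the second row is reflected
    -- The offset that puts the mirror image of `[a', a' + n]` over `[a, a + n]`. Shifts are natural
    -- numbers, so its positive part moves one half and its negative part the other.
    let d : ℤ := tile (T + 1) k k - 1 - a' - n - a
    let θ : Bool → Bool × ℕ := fun h => if h then (true, d.toNat) else (false, (-d).toNat)
    have hθ : ∀ h, ((θ h).2 : ℤ) ≤ tile (T + 1) k k := by
      intro h; cases h <;> simp only [θ, d, Bool.false_eq_true, ↓reduceIte] <;> omega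
    have t1 := htrans θ hθ true a m1 (a + n) m2
    have t2 := htrans θ hθ false (a' + n) m4 a' m3
    have e := hrows θ hθ (a + d.toNat) (a + n + d.toNat) (by omega) (by omega) (by omega)
      (by omega)
    simp only [θ, Bool.false_eq_true, ↓reduceIte] at t1 t2
    rw [place_apply _ _ (by omega) (by omega), place_apply _ _ (by omega) (by omega)] at t1 t2
    simp only [Bool.false_eq_true, ↓reduceIte] at t1 t2
    rw [show tile (T + 1) k k + ((-d).toNat : ℤ) - 1 - a' = a + n + d.toNat by omega,
      show tile (T + 1) k k + ((-d).toNat : ℤ) - 1 - (a' + n) = a + d.toNat by omega] at t2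
    rw [t1, t2, abs_le] at e
    rcases hε with rfl | rfl <;> rcases hε' with rfl | rfl <;> omega
  -- The directions are already opposite, so translations suffice.
  · let d : ℤ := a' - a
    let θ : Bool → Bool × ℕ := fun h => if h then (true, d.toNat) else (true, (-d).toNat)
    have hθ : ∀ h, ((θ h).2 : ℤ) ≤ tile (T + 1) k k := by
      intro h; cases h <;> simp only [θ, d, Bool.false_eq_true, ↓reduceIte] <;> omega
    have t1 := htrans θ hθ true a m1 (a + n) m2
    have t2 := htrans θ hθ false a' m3 (a' + n) m4
    have e := hrows θ hθ (a + d.toNat) (a + n + d.toNat) (by omega) (by omega) (by omega)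
      (by omega)
    simp only [θ, Bool.false_eq_true, ↓reduceIte] at t1 t2
    rw [place_apply _ _ (by omega) (by omega), place_apply _ _ (by omega) (by omega)] at t1 t2
    simp only [↓reduceIte] at t1 t2
    rw [show a' + n + ((-d).toNat : ℤ) = a + n + d.toNat by omega,
      show a' + ((-d).toNat : ℤ) = a + d.toNat by omega] at t2
    rw [t1, t2, abs_le] at e
    rcases hε with rfl | rfl <;> rcases hε' with rfl | rfl <;> omega

end

/-! ### The lower bound -/

/-- The infinite bit sequence that starts with the given bits. -/
def extendBits {k : ℕ} (b : Fin k → Bool) (i : ℕ) : Bool := if h : i < k then b ⟨i, h⟩ else false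

/-- If each deterministic algorithm fails on one of fewer than `n` inputs, then no randomized
algorithm colours all of them. -/
theorem not_colors_of_forall_exists {n : ℕ} {C ι : Type*} [Fintype ι] {F : Set (SimpleGraph (Fin n))}
    {T : ℕ} (G : ι → SimpleGraph (Fin n)) (hG : ∀ i, G i ∈ F) (σ : Equiv.Perm (Fin n))
    (hcard : Fintype.card ι < n)
    (h : ∀ A : DetAlgorithm n C, ∃ i, ¬ IsProper (G i) (output A (G i) T σ))
    (μ : RandAlgorithm n C) : ¬ Colors F T μ := by
  intro hμ
  have hcover : (⋃ i, {A : DetAlgorithm n C | ¬ IsProper (G i) (output A (G i) T σ)}) =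
      Set.univ := by
    ext A
    simpa using h A
  have hone : μ.toOuterMeasure Set.univ = 1 :=
    (μ.toOuterMeasure_apply_eq_one_iff _).2 (Set.subset_univ _)
  have hle : (1 : ENNReal) ≤ Fintype.card ι * (1 / (n : ENNReal)) := by
    calc (1 : ENNReal) = μ.toOuterMeasure
          (⋃ i, {A | ¬ IsProper (G i) (output A (G i) T σ)}) := by rw [hcover, hone]
      _ ≤ ∑' i, μ.toOuterMeasure {A | ¬ IsProper (G i) (output A (G i) T σ)} :=
          MeasureTheory.measure_iUnion_le _
      _ = ∑ i, μ.toOuterMeasure {A | ¬ IsProper (G i) (output A (G i) T σ)} := tsum_fintype _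
      _ ≤ ∑ _i : ι, 1 / (n : ENNReal) := Finset.sum_le_sum fun i _ => hμ (G i) (hG i) σ
      _ = Fintype.card ι * (1 / (n : ENNReal)) := by simp
  have hn : (n : ENNReal) ≠ 0 := by
    rw [Nat.cast_ne_zero]
    omega
  rw [mul_one_div, ENNReal.le_div_iff_mul_le (Or.inl hn) (Or.inl (by simp)), one_mul] at hle
  exact absurd (by exact_mod_cast hle : n ≤ Fintype.card ι) (by omega)

theorem not_colors_squareGrids {m T k e : ℕ} (hk : k = 3 * (4 * T + 7))
    (he : (e : ℤ) = tile (T + 1) k k) (hm : 2 * e ≤ m) (hmT : 2 * T + 3 < m)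
    (hcard : 2 ^ k * (2 * (e + 1)) ^ 2 < m ^ 2) (μ : RandAlgorithm (m ^ 2) (Fin 3)) :
    ¬ Colors (squareGrids (m ^ 2)) T μ := by
  obtain ⟨K⟩ := nonempty_coordinates (show 0 < m by omega)
  obtain ⟨σ, hσ⟩ := exists_order K T k
  have hm' : 2 * tile (T + 1) k k ≤ m := by rw [← he]; exact_mod_cast hm
  -- Only the first `k` bits matter, and each half has `2 * (e + 1)` placements; this gives the
  -- count in `hcard`.
  let choice : (Fin k → Bool) × (Bool → Bool × Fin (e + 1)) → Choice := fun s =>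
    (extendBits s.1, fun h => ((s.2 h).1, ((s.2 h).2 : ℕ)))
  have hle : ∀ s h, (((choice s).2 h).2 : ℤ) ≤ tile (T + 1) k k := fun s h => by
    rw [← he]
    exact_mod_cast Nat.lt_succ_iff.1 (s.2 h).2.isLt
  refine not_colors_of_forall_exists (fun s => gridOf (position K T k (choice s)))
    (fun s => gridOf_position_mem K (hle s) hm') σ ?_ (fun A => ?_) μ
  · simpa [Fintype.card_pi] using hcard
  · obtain ⟨s, hs, hfail⟩ := not_forall_isProper (K := K)
      (col := fun s => output A (gridOf (position K T k s)) T σ) hk hm' hmT (hσ A)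
    refine ⟨(fun i => s.1 i, fun h => ((s.2 h).1, ⟨(s.2 h).2, ?_⟩)), ?_⟩
    · have := hs h
      omega
    · have hpos : position K T k (choice (fun i => s.1 i, fun h => ((s.2 h).1, ⟨(s.2 h).2, by
          have := hs h; omega⟩))) = position K T k s := by
        have harr : arrange (T + 1) k (extendBits fun i : Fin k => s.1 i) k =
            arrange (T + 1) k s.1 k := arrange_congr fun i hi => by simp [extendBits, hi]
        funext u
        simp only [position, columns, choice, harr]
      simp only [hpos]
      exact hfail

/-- Here `k = 12 * T + 21` and `e ≤ 2 ^ (14 * T + 27)`, so there are at most `2 ^ (40 * T + 79)`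
inputs, while `m ^ 2 ≥ 2 ^ (100 * (T + 1))`. -/
theorem not_colors_of_two_pow_le {m T : ℕ} (hm : 2 ^ (50 * (T + 1)) ≤ m)
    (μ : RandAlgorithm (m ^ 2) (Fin 3)) : ¬ Colors (squareGrids (m ^ 2)) T μ := by
  obtain ⟨k, hk⟩ : ∃ k, k = 3 * (4 * T + 7) := ⟨_, rfl⟩
  obtain ⟨e, he⟩ : ∃ e, e = 2 ^ k * (2 * (k + 1) * (T + 1) + 2) := ⟨_, rfl⟩
  have hT : T + 1 ≤ 2 ^ T := Nat.lt_two_pow_self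
  have h1 : 2 * (k + 1) * (T + 1) + 2 ≤ 2 ^ (2 * T + 6) := by
    have : 2 ^ (2 * T + 6) = 64 * (2 ^ T * 2 ^ T) := by ring
    rw [this]
    have : (T + 1) * (T + 1) ≤ 2 ^ T * 2 ^ T := Nat.mul_le_mul hT hT
    subst hk
    nlinarith
  have h2 : e ≤ 2 ^ (14 * T + 27) := by
    calc e ≤ 2 ^ k * 2 ^ (2 * T + 6) := he ▸ Nat.mul_le_mul_left _ h1
      _ = 2 ^ (14 * T + 27) := by rw [← pow_add]; congr 1; omega
  have he' : (e : ℤ) = tile (T + 1) k k := by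
    rw [he, tile]
    push_cast
    rfl
  have h3 : 0 < e := by
    have := tile_pos (T + 1) k k
    rw [← he'] at this
    exact_mod_cast this
  refine not_colors_squareGrids hk he' ?_ ?_ ?_ μ
  · calc 2 * e ≤ 2 * 2 ^ (14 * T + 27) := by omega
      _ = 2 ^ (14 * T + 28) := by ring
      _ ≤ 2 ^ (50 * (T + 1)) := Nat.pow_le_pow_right (by omega) (by omega)
      _ ≤ m := hm
  · calc 2 * T + 3 < 4 * (T + 1) := by omega
      _ ≤ 4 * 2 ^ T := by omega
      _ = 2 ^ (T + 2) := by ring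
      _ ≤ 2 ^ (50 * (T + 1)) := Nat.pow_le_pow_right (by omega) (by omega)
      _ ≤ m := hm
  · calc 2 ^ k * (2 * (e + 1)) ^ 2 ≤ 2 ^ k * (4 * e) ^ 2 :=
          Nat.mul_le_mul_left _ (Nat.pow_le_pow_left (by omega) 2)
      _ ≤ 2 ^ k * (4 * 2 ^ (14 * T + 27)) ^ 2 := by gcongr
      _ = 2 ^ (40 * T + 79) := by rw [hk]; ring
      _ < 2 ^ (100 * (T + 1)) := Nat.pow_lt_pow_right (by omega) (by omega)
      _ = (2 ^ (50 * (T + 1))) ^ 2 := by ring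
      _ ≤ m ^ 2 := by gcongr

theorem log_le_of_colors {m T : ℕ} (hm : 2 ^ 100 ≤ m) (μ : RandAlgorithm (m ^ 2) (Fin 3))
    (h : Colors (squareGrids (m ^ 2)) T μ) :
    1 / 200 * Real.log ((m ^ 2 : ℕ) : ℝ) ≤ T := by
  by_contra! hlt
  refine not_colors_of_two_pow_le ?_ μ h
  have hm0 : (0 : ℝ) < m := by
    have : 0 < m := lt_of_lt_of_le (by positivity) hm
    exact_mod_cast this
  have hm1 : (2 : ℝ) ^ 100 ≤ m := by exact_mod_cast hm
  push_cast at hlt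
  rw [Real.log_pow] at hlt
  have hlog : 100 * Real.log 2 ≤ Real.log m := by
    have := Real.log_le_log (by positivity) hm1
    rwa [Real.log_pow, Nat.cast_ofNat] at this
  have h2 := Real.log_two_lt_d9
  have h2' := Real.log_two_gt_d9
  -- Half of `log m` pays for `50 * T * log 2`, as `T < log m / 100`; the other half pays for `50 *
  -- log 2`, as `m ≥ 2 ^ 100`.
  have key : ((50 * (T + 1) : ℕ) : ℝ) * Real.log 2 ≤ Real.log m := by
    push_cast at hlt ⊢
    nlinarith
  rw [← Real.log_pow] at key
  exact_mod_cast (Real.log_le_log_iff (by positivity) hm0).1 key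

end OnlineLocal

theorem mainTheorem9 :
    (∃ c : ℝ, 0 < c ∧ ∃ m₀ : ℕ, ∀ m : ℕ, m₀ ≤ m →
      ∀ (T : ℕ) (μ : OnlineLocal.RandAlgorithm (m ^ 2) (Fin 3)),
        OnlineLocal.Colors (OnlineLocal.squareGrids (m ^ 2)) T μ →
          c * Real.log ((m ^ 2 : ℕ) : ℝ) ≤ (T : ℝ)) ∧
    (∀ T : ℕ → ℕ,
      Asymptotics.IsLittleO Filter.atTop (fun n : ℕ => (T n : ℝ)) (fun n : ℕ => Real.log (n : ℝ)) →
        ¬ ∃ μ : (n : ℕ) → OnlineLocal.RandAlgorithm n (Fin 3),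
          ∀ᶠ n in Filter.atTop, OnlineLocal.Colors (OnlineLocal.bipartiteGraphs n) (T n) (μ n)) := by
  refine ⟨⟨1 / 200, by norm_num, 2 ^ 100, fun m hm T μ h =>
    OnlineLocal.log_le_of_colors hm μ h⟩, ?_⟩
  rintro T hT ⟨μ, hμ⟩
  -- Any constant below `1 / 200` contradicts the first part along the squares.
  have hsmall := hT.bound (show (0 : ℝ) < 1 / 400 by norm_num)
  obtain ⟨N, hN⟩ := Filter.eventually_atTop.1 (hsmall.and hμ)
  obtain ⟨m, hm⟩ : ∃ m, m = N + 2 ^ 100 := ⟨_, rfl⟩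
  have hm1 : 2 ^ 100 ≤ m := by omega
  obtain ⟨h1, h2⟩ := hN (m ^ 2) (by nlinarith)
  have h3 := OnlineLocal.log_le_of_colors hm1 _ fun G hG σ =>
    h2 G (OnlineLocal.squareGrids_subset_bipartiteGraphs _ hG) σ
  have hpos : 0 < Real.log ((m ^ 2 : ℕ) : ℝ) := by
    apply Real.log_pos
    have : 1 < m ^ 2 := Nat.one_lt_pow (by norm_num) (by omega)
    exact_mod_cast this
  rw [Real.norm_of_nonneg (by positivity), Real.norm_of_nonneg hpos.le] at h1
  linarith
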